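/- For integers $m,n\ge 2$, the $m\times n$ toroidal queen's graph $TQ_{m,n}$ is the simple graph on $\mathbb{Z}/m\times\mathbb{Z}/n$ in which two distinct vertices $(x,y),(x',y')$ are adjacent iff $x=x'$, or $y=y'$, or $(x',y')=(x+k,y+k)$ for some $k\in\mathbb{Z}$, or $(x',y')=(x+k,y-k)$ for some $k\in\mathbb{Z}$. Let $\alpha$ denote the independence number. A divisor on a graph $G$ is an element $D\in\mathbb{Z}^{V(G)}$; its degree is $\sum_v D(v)$, and it is effective if $D(v)\ge 0$ for all $v$. Firing a vertex $v$ moves one chip from $v$ along each edge at $v$ to the neighbor; divisors are equivalent if they differ by a sequence of firings and reverse firings, and $[D]$ is the class of $D$. The rank $r(D)$ is $-1$ if $D$ is not equivalent to an effective divisor, and otherwise the largest $k\ge 0$ such that $D-E$ is equivalent to an effective divisor for every effective $E$ of degree $k$. The gonality $\mathrm{gon}(G)$ is the minimum degree of a divisor of positive rank. Theorem. Let $m,n\ge 2$. Then \[\mathrm{gon}(TQ_{m,n})=mn-\alpha(TQ_{m,n}).\] For $m=n$, \[\mathrm{gon}(TQ_{n,n})=\begin{cases}n(n-1)&\text{if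 }\gcd(6,n)=1,\\ n(n-1)+1&\text{if }\gcd(6,n)\ne 1,\ 3\nmid n\text{ and }4\nmid n,\\ n(n-1)+2&\text{in all other cases.}\end{cases}\] For $m\ne n$ and $\{m,n\}\ne\{3,6\}$, $\mathrm{gon}(TQ_{m,n})=mn-\gcd(m,n)$, while $\mathrm{gon}(TQ_{3,6})=\mathrm{gon}(TQ_{6,3})=16$. Moreover, for all $m,n\ge2$, sending $S$ to $[\mathbb{1}_{S^c}]$, where $\mathbb{1}_{S^c}$ has one chip on every vertex outside $S$ and none on $S$, is a one-to-one correspondence from the maximum independent sets of $TQ_{m,n}$ onto the divisor classes $[D]$ on $TQ_{m,n}$ of rank $1$ and degree $\mathrm{gon}(TQ_{m,n})$. -/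

import Mathlib

/-! Chip-firing on a finite simple graph. -/

namespace ChipFiring

/-- A divisor: an integer number of chips on every vertex. -/
abbrev Divisor (V : Type*) : Type _ := V → ℤ

/-- The degree of a divisor: the total number of chips. -/
def degree {V : Type*} [Fintype V] (D : Divisor V) : ℤ := ∑ v, D v

/-- A divisor is effective if no vertex is in debt. -/
def Effective {V : Type*} (D : Divisor V) : Prop := ∀ v, 0 ≤ D v

open Classical in
/-- The result of firing each vertex `v` exactly `f v` times, starting from `D`: each firing of `v`
moves one chip from `v` along every edge at `v` (a negative number of firings stands for the
reverse moves). So `w` gains `f u` chips from each neighbor `u` and loses `f w` chips to it. -/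
noncomputable def fire {V : Type*} [Fintype V] (G : SimpleGraph V) (f : V → ℤ) (D : Divisor V) :
    Divisor V :=
  fun w => D w + ∑ u ∈ G.neighborFinset w, (f u - f w)

/-- Two divisors are equivalent if they differ by a sequence of chip-firing moves. -/
def Equivalent {V : Type*} [Fintype V] (G : SimpleGraph V) (D D' : Divisor V) : Prop :=
  ∃ f : V → ℤ, D' = fire G f D

theorem equivalent_equivalence {V : Type*} [Fintype V] (G : SimpleGraph V) :
    Equivalence (Equivalent G) where
  refl D := ⟨0, by funext w; simp [fire]⟩
  symm := by
    rintro D _ ⟨f, rfl⟩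
    refine ⟨-f, ?_⟩
    funext w
    simp only [fire, Pi.neg_apply, add_assoc, ← Finset.sum_add_distrib]
    rw [Finset.sum_eq_zero (fun u _ => by ring), add_zero]
  trans := by
    rintro D _ _ ⟨f, rfl⟩ ⟨g, rfl⟩
    refine ⟨f + g, ?_⟩
    funext w
    simp only [fire, Pi.add_apply, add_assoc, ← Finset.sum_add_distrib]
    congr 1
    exact Finset.sum_congr rfl (fun u _ => by ring)

/-- Equivalence of divisors as a setoid. -/
def divisorSetoid {V : Type*} [Fintype V] (G : SimpleGraph V) : Setoid (Divisor V) :=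
  ⟨Equivalent G, equivalent_equivalence G⟩

/-- The type of divisor classes on `G`. -/
def DivisorClass {V : Type*} [Fintype V] (G : SimpleGraph V) : Type _ :=
  Quotient (divisorSetoid G)

/-- The class `[D]` of a divisor `D`. -/
def divisorClass {V : Type*} [Fintype V] (G : SimpleGraph V) (D : Divisor V) : DivisorClass G :=
  Quotient.mk (divisorSetoid G) D

/-- `D` is equivalent to some effective divisor. -/
def Winnable {V : Type*} [Fintype V] (G : SimpleGraph V) (D : Divisor V) : Prop :=
  ∃ D' : Divisor V, Equivalent G D D' ∧ Effective D'

/-- `r(D) ≥ k`: for every effective `E` of degree `k`, `D - E` is equivalent to an effective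
divisor. -/
def RankAtLeast {V : Type*} [Fintype V] (G : SimpleGraph V) (D : Divisor V) (k : ℕ) : Prop :=
  ∀ E : Divisor V, Effective E → degree E = k → Winnable G (D - E)

open Classical in
/-- The rank `r(D)` of a divisor: `-1` if `D` is not equivalent to an effective divisor, and
otherwise the largest `k` with `r(D) ≥ k` (on a non-empty graph such `k` are at most `deg D`). -/
noncomputable def rank {V : Type*} [Fintype V] (G : SimpleGraph V) (D : Divisor V) : ℤ :=
  if Winnable G D then ((sSup {k : ℕ | RankAtLeast G D k} : ℕ) : ℤ) else -1

/-- The gonality of `G`: the minimum degree of a divisor of positive rank (a divisor of positive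
rank is equivalent to an effective one, so its degree is a natural number). -/
noncomputable def gonality {V : Type*} [Fintype V] (G : SimpleGraph V) : ℕ :=
  sInf {d : ℕ | ∃ D : Divisor V, degree D = d ∧ 0 < rank G D}

/-- The divisor with one chip on every vertex outside `S` and no chips on `S`. -/
noncomputable def complDivisor {V : Type*} (S : Finset V) : Divisor V :=
  Set.indicator ((S : Set V)ᶜ) 1

end ChipFiring

/-- The `m × n` toroidal queen's graph. The vertex `(x, y)` is in column `x` (of `m`) and row `y`
(of `n`). Two distinct vertices are adjacent if they are in the same column or row, or lie along a
diagonal of slope `1` or `-1`, the diagonals being continued across the boundary of the torus. -/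
def toroidalQueenGraph (m n : ℕ) : SimpleGraph (ZMod m × ZMod n) where
  Adj p q := p ≠ q ∧ (p.1 = q.1 ∨ p.2 = q.2 ∨
    (∃ k : ℤ, q.1 = p.1 + k ∧ q.2 = p.2 + k) ∨
    (∃ k : ℤ, q.1 = p.1 + k ∧ q.2 = p.2 - k))
  symm := ⟨by
    rintro p q ⟨h, h' | h' | ⟨k, h1, h2⟩ | ⟨k, h1, h2⟩⟩
    · exact ⟨h.symm, Or.inl h'.symm⟩
    · exact ⟨h.symm, Or.inr (Or.inl h'.symm)⟩
    · exact ⟨h.symm, Or.inr (Or.inr (Or.inl ⟨-k, by simp [h1], by simp [h2]⟩))⟩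
    · exact ⟨h.symm, Or.inr (Or.inr (Or.inr ⟨-k, by simp [h1], by simp [h2]⟩))⟩⟩
  loopless := ⟨fun p h => h.1 rfl⟩

/-! Write N = mn, d = gcd(m, n), and α for the independence number.

Upper bound: if S is independent, 1_{S^c} has positive rank. Firing everything except v ∈ S takes
one chip from each neighbor of v, and these neighbors lie outside S.

Lower bound: let D have positive rank and degree at most N − α. The board is so well connected that
an edge cut of at most N − α edges has a side with at most s vertices, where s is 1 or about d/2.
With fewer than N chips, sets of at most s vertices cannot be fired forever, so D may be taken
effective with no such set ready to fire (`exists_no_small_legal`). Bringing a chip to a zero z of D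
then means firing the complement of a set W ∋ z with at most s vertices. Let Z be the set of zeros
and I a largest independent subset of Z. Any z ∈ Z \ I has a neighbor in I; the two have at least
five common neighbors outside the relevant W, and these must carry surplus chips, while a vertex is
adjacent to at most four elements of I. So 5|Z \ I| ≤ 4 · surplus, whereas the degree bound gives
surplus ≤ |Z \ I|. Both vanish, and D = 1_{Z^c} with Z maximum independent
(`FiringDichotomy.eq_complDivisor`). This yields the gonality and surjectivity onto the classes;
`FiringDichotomy.eq_of_equivalent` gives injectivity. The graph properties used are collected in
`FiringDichotomy` and verified in `IsQueenGraph.firingDichotomy`, where diagonals are fibers of sums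
and differences of maps to ℤ/d.

Independence numbers: the diagonals partition the board into d cliques, so α ≤ d. Explicit piecewise
linear placements give the lower bounds. On square boards, n or n − 1 queens are excluded by summing
coordinates and their squares over the queens (`card_ne_of_even`, `dvd_two_mul_sum_sq`); for sides 3
and 6, α = 2 is a statement about residues modulo 3. -/

set_option linter.unusedSectionVars false

namespace ChipFiring

/-! ### Legal firing of vertex sets, and basic properties of the rank -/

section FiringSets

open scoped Classical
open Finset

variable {V : Type*} [Fintype V] [DecidableEq V] (G : SimpleGraph V)

/-- The neighbors of a vertex. -/
noncomputable def nbrs (v : V) : Finset V := {u | G.Adj v u}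

@[simp] theorem mem_nbrs {v u : V} : u ∈ nbrs G v ↔ G.Adj v u := by simp [nbrs]

/-- The number of edges between a set of vertices and its complement. -/
noncomputable def cut (U : Finset V) : ℕ := ∑ u ∈ U, #(nbrs G u \ U)

/-- All vertices of `U` can be fired simultaneously without any of them going into debt. -/
def Legal (D : Divisor V) (U : Finset V) : Prop := ∀ u ∈ U, (#(nbrs G u \ U) : ℤ) ≤ D u

/-- The firing script that fires each vertex of `U` once. -/
noncomputable def once (U : Finset V) : V → ℤ := fun v => if v ∈ U then 1 else 0

theorem fire_apply (f : V → ℤ) (D : Divisor V) (w : V) :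
    fire G f D w = D w + ∑ u ∈ nbrs G w, (f u - f w) := by
  unfold fire
  congr 1
  exact Finset.sum_congr (by ext; simp) fun _ _ => rfl

theorem degree_fire (f : V → ℤ) (D : Divisor V) : degree (fire G f D) = degree D := by
  unfold degree
  simp only [fire_apply, Finset.sum_add_distrib]
  have h : ∑ w, ∑ u ∈ nbrs G w, (f u - f w) = ∑ w, ∑ u, if G.Adj w u then f u - f w else 0 := by
    simp only [nbrs, Finset.sum_filter]
  -- The summand is antisymmetric in the two ends of an edge, so the double sum equals its own
  -- negative.
  have h' : ∑ w, ∑ u, (if G.Adj w u then f u - f w else 0) =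
      - ∑ w, ∑ u, (if G.Adj w u then f u - f w else 0) := by
    conv_lhs => rw [Finset.sum_comm]
    simp only [← Finset.sum_neg_distrib]
    refine Finset.sum_congr rfl fun w _ => Finset.sum_congr rfl fun u _ => ?_
    simp only [G.adj_comm u w]
    split_ifs <;> ring
  rw [h]
  linarith

theorem Equivalent.degree_eq {D D' : Divisor V} (h : Equivalent G D D') :
    degree D' = degree D := by
  obtain ⟨f, rfl⟩ := h
  exact degree_fire G f D

theorem Effective.degree_nonneg {D : Divisor V} (h : Effective D) : 0 ≤ degree D :=
  Finset.sum_nonneg fun v _ => h v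

theorem fire_once_of_mem {U : Finset V} (D : Divisor V) {v : V} (hv : v ∈ U) :
    fire G (once U) D v = D v - #(nbrs G v \ U) := by
  rw [fire_apply, ← Finset.sum_sdiff (Finset.inter_subset_left (s₁ := nbrs G v) (s₂ := U)),
    Finset.sdiff_inter_self_left]
  rw [Finset.sum_congr rfl (g := fun _ => (-1 : ℤ)) (s₁ := nbrs G v \ U), 
    Finset.sum_congr rfl (g := fun _ => (0 : ℤ)) (s₁ := nbrs G v ∩ U)]
  · simp; ring
  · intro x hx
    simp [once, hv, (Finset.mem_inter.1 hx).2]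
  · intro x hx
    simp [once, hv, (Finset.mem_sdiff.1 hx).2]

theorem fire_once_of_notMem {U : Finset V} (D : Divisor V) {v : V} (hv : v ∉ U) :
    fire G (once U) D v = D v + #(nbrs G v ∩ U) := by
  rw [fire_apply]
  simp [once, hv]

theorem Legal.effective_fire {D : Divisor V} {U : Finset V} (hD : Effective D)
    (h : Legal G D U) : Effective (fire G (once U) D) := by
  intro v
  by_cases hv : v ∈ U
  · rw [fire_once_of_mem G D hv]
    linarith [h v hv]
  · rw [fire_once_of_notMem G D hv]
    linarith [hD v, (Nat.cast_nonneg (#(nbrs G v ∩ U)) : (0 : ℤ) ≤ _)]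

theorem Legal.cut_le_degree {D : Divisor V} {U : Finset V} (hD : Effective D)
    (h : Legal G D U) : (cut G U : ℤ) ≤ degree D := by
  unfold cut degree
  push_cast
  exact (Finset.sum_le_sum h).trans
    (Finset.sum_le_sum_of_subset_of_nonneg (Finset.subset_univ U) fun v _ _ => hD v)

theorem cut_compl (U : Finset V) : cut G Uᶜ = cut G U := by
  unfold cut
  have key : ∀ U : Finset V, ∑ u ∈ U, #(nbrs G u \ U) =
      ∑ u, ∑ w, if u ∈ U ∧ w ∉ U ∧ G.Adj u w then 1 else 0 := by
    intro U
    rw [← Finset.sum_subset (Finset.subset_univ U)]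
    · refine Finset.sum_congr rfl fun u hu => ?_
      rw [Finset.card_eq_sum_ones, ← Finset.sum_filter]
      refine Finset.sum_congr ?_ fun _ _ => rfl
      ext w
      simp [hu, and_comm]
    · intro u _ hu
      simp [hu]
  rw [key, key, Finset.sum_comm]
  refine Finset.sum_congr rfl fun u _ => Finset.sum_congr rfl fun w _ => ?_
  congr 1
  simp only [mem_compl, not_not, G.adj_comm w u, eq_iff_iff]
  tauto

theorem Legal.compl_apply {D : Divisor V} {U : Finset V} (h : Legal G D U) {u : V} (hu : u ∉ Uᶜ) :
    (#(nbrs G u ∩ Uᶜ) : ℤ) ≤ D u := by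
  have := h u (by simpa using hu)
  rwa [Finset.sdiff_eq_inter_compl] at this

/-- The vertices fired most often by a script that keeps the divisor effective. -/
theorem exists_legal_of_fire {D : Divisor V} {f : V → ℤ} (hD' : Effective (fire G f D)) {z : V}
    (hz : D z < fire G f D z) :
    ∃ U : Finset V, U.Nonempty ∧ z ∉ U ∧ Legal G D U ∧ ∃ M, (∀ u ∈ U, f u = M) ∧
      ∀ u ∉ U, f u < M := by
  obtain ⟨x, -, hx⟩ := Finset.exists_max_image Finset.univ f ⟨z, Finset.mem_univ z⟩
  -- A vertex where `f` is maximal gains nothing, and loses at least one chip to each neighbor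
  -- outside the level set.
  have key : ∀ u, f u = f x → fire G f D u ≤ D u - #(nbrs G u \ ({v | f v = f x} : Finset V)) := by
    intro u hu
    rw [fire_apply, ← Finset.sum_sdiff (Finset.inter_subset_left (s₁ := nbrs G u)
      (s₂ := ({v | f v = f x} : Finset V))), Finset.sdiff_inter_self_left]
    have h1 : ∑ w ∈ nbrs G u \ ({v | f v = f x} : Finset V), (f w - f u) ≤
        ∑ w ∈ nbrs G u \ ({v | f v = f x} : Finset V), (-1) := by
      refine Finset.sum_le_sum fun w hw => ?_
      have h2 := hx w (Finset.mem_univ w)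
      have h3 : f w ≠ f x := by simpa using (Finset.mem_sdiff.1 hw).2
      omega
    have h2 : ∑ w ∈ nbrs G u ∩ ({v | f v = f x} : Finset V), (f w - f u) = 0 :=
      Finset.sum_eq_zero fun w hw => by
        have := (Finset.mem_inter.1 hw).2
        simp only [mem_filter, mem_univ, true_and] at this
        omega
    rw [Finset.sum_const, nsmul_eq_mul] at h1
    linarith
  refine ⟨({v | f v = f x} : Finset V), ⟨x, by simp⟩, ?_, ?_, f x, by simp, ?_⟩
  · intro h
    have := key z (by simpa using h)
    have h0 : (0 : ℤ) ≤ #(nbrs G z \ ({v | f v = f x} : Finset V)) := Nat.cast_nonneg _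
    linarith
  · intro u hu
    have := key u (by simpa using hu)
    linarith [hD' u]
  · intro u hu
    have h2 := hx u (Finset.mem_univ u)
    have h3 : f u ≠ f x := by simpa using hu
    omega

theorem Winnable.of_equivalent {D D' : Divisor V} (h : Equivalent G D D') (hD : Winnable G D) :
    Winnable G D' := by
  obtain ⟨E, hE, hE'⟩ := hD
  exact ⟨E, (equivalent_equivalence G).trans ((equivalent_equivalence G).symm h) hE, hE'⟩

theorem equivalent_sub_right {D D' : Divisor V} (h : Equivalent G D D') (E : Divisor V) :
    Equivalent G (D - E) (D' - E) := by
  obtain ⟨f, rfl⟩ := h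
  refine ⟨f, ?_⟩
  funext w
  simp only [fire_apply, Pi.sub_apply]
  ring

theorem RankAtLeast.of_equivalent {D D' : Divisor V} {k : ℕ} (h : Equivalent G D D')
    (hD : RankAtLeast G D k) : RankAtLeast G D' k := fun E hE hk =>
  (hD E hE hk).of_equivalent G (equivalent_sub_right G h E)

theorem degree_add (D E : Divisor V) : degree (D + E) = degree D + degree E := by
  simp [degree, Finset.sum_add_distrib]

theorem degree_sub (D E : Divisor V) : degree (D - E) = degree D - degree E := by
  simp [degree, Finset.sum_sub_distrib]

theorem degree_single (v : V) (c : ℤ) : degree (Pi.single v c : Divisor V) = c := by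
  simp [degree]

theorem effective_single (v : V) {c : ℤ} (hc : 0 ≤ c) : Effective (Pi.single v c : Divisor V) := by
  intro w
  by_cases h : w = v
  · subst h; simpa using hc
  · simp [h]

theorem Winnable.degree_nonneg {D : Divisor V} (h : Winnable G D) : 0 ≤ degree D := by
  obtain ⟨E, hE, hE'⟩ := h
  rw [← hE.degree_eq]
  exact hE'.degree_nonneg

theorem Winnable.add_effective {D E : Divisor V} (h : Winnable G D) (hE : Effective E) :
    Winnable G (D + E) := by
  obtain ⟨D', ⟨f, rfl⟩, hD'⟩ := h
  refine ⟨_, ⟨f, rfl⟩, fun w => ?_⟩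
  have h1 := hD' w
  have h2 := hE w
  simp only [fire_apply, Pi.add_apply] at h1 ⊢
  linarith

theorem RankAtLeast.le_degree [Nonempty V] {D : Divisor V} {k : ℕ} (h : RankAtLeast G D k) :
    (k : ℤ) ≤ degree D := by
  obtain ⟨v⟩ := ‹Nonempty V›
  have := (h (Pi.single v k) (effective_single v (by positivity)) (degree_single v k)).degree_nonneg
  rw [degree_sub, degree_single] at this
  linarith

theorem RankAtLeast.sub_single {D : Divisor V} {k : ℕ} (h : RankAtLeast G D (k + 1)) (v : V) :
    RankAtLeast G (D - Pi.single v 1) k := by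
  intro E hE hk
  rw [sub_sub]
  refine h _ (fun w => ?_) ?_
  · exact add_nonneg (effective_single v zero_le_one w) (hE w)
  · rw [degree_add, degree_single, hk]
    push_cast
    ring

theorem RankAtLeast.of_succ [Nonempty V] {D : Divisor V} {k : ℕ} (h : RankAtLeast G D (k + 1)) :
    RankAtLeast G D k := by
  obtain ⟨v⟩ := ‹Nonempty V›
  intro E hE hk
  have := (h.sub_single G v E hE hk).add_effective G (effective_single v zero_le_one)
  convert this using 1
  abel

theorem RankAtLeast.mono [Nonempty V] {D : Divisor V} {k l : ℕ} (hkl : k ≤ l)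
    (h : RankAtLeast G D l) : RankAtLeast G D k := by
  induction hkl with
  | refl => exact h
  | step _ ih => exact ih (h.of_succ G)

theorem bddAbove_rankAtLeast [Nonempty V] (D : Divisor V) :
    BddAbove {k : ℕ | RankAtLeast G D k} :=
  ⟨(degree D).toNat, fun k hk => by have := RankAtLeast.le_degree G hk; omega⟩

theorem rankAtLeast_one_of_rank_pos [Nonempty V] {D : Divisor V} (h : 0 < rank G D) :
    RankAtLeast G D 1 := by
  unfold rank at h
  split_ifs at h with hw
  · have hne : {k : ℕ | RankAtLeast G D k}.Nonempty := by
      by_contra hne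
      rw [Set.not_nonempty_iff_eq_empty.1 hne] at h
      simp at h
    have := Nat.sSup_mem hne (bddAbove_rankAtLeast G D)
    exact RankAtLeast.mono G (by exact_mod_cast h) this
  · omega

theorem rank_pos_of_rankAtLeast_one [Nonempty V] {D : Divisor V} (h : RankAtLeast G D 1) :
    0 < rank G D := by
  have hw : Winnable G D := by
    have := (h.of_succ G) 0 (fun _ => le_rfl) (by simp [degree])
    simpa using this
  unfold rank
  rw [if_pos hw]
  have := le_csSup (bddAbove_rankAtLeast G D) h
  exact_mod_cast this

theorem rank_le_one_of_not_rankAtLeast_two [Nonempty V] {D : Divisor V}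
    (h : ¬ RankAtLeast G D 2) : rank G D ≤ 1 := by
  unfold rank
  split_ifs with hw
  · have hne : {k : ℕ | RankAtLeast G D k}.Nonempty :=
      ⟨0, fun E hE hk => by
        have hE0 : E = 0 := by
          funext v
          exact (Finset.sum_eq_zero_iff_of_nonneg fun v _ => hE v).1 hk v (Finset.mem_univ v)
        simpa [hE0] using hw⟩
    have hmem := Nat.sSup_mem hne (bddAbove_rankAtLeast G D)
    by_contra hcon
    exact h (RankAtLeast.mono G (by omega) hmem)
  · omega

end FiringSets

/-! ### Firing small sets terminates when there are few chips -/

section Termination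

open scoped Classical
open Finset

variable {V : Type*} [Fintype V] [DecidableEq V] (G : SimpleGraph V)

/-- Any two distinct vertices are adjacent or have a common neighbor. -/
def DiameterLeTwo : Prop := ∀ u v, u ≠ v → G.Adj u v ∨ ∃ w, G.Adj u w ∧ G.Adj v w

/-- Maximum principle: where `f` is maximal all terms `f w - f y` are nonpositive and sum to zero,
so the maximum spreads to all neighbors. -/
theorem eq_of_fire_eq_self (hG : DiameterLeTwo G) {D : Divisor V} {f : V → ℤ}
    (h : fire G f D = D) (u v : V) : f u = f v := by
  obtain ⟨x, -, hx⟩ := Finset.exists_max_image Finset.univ f ⟨u, Finset.mem_univ u⟩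
  have step : ∀ y, f y = f x → ∀ w, G.Adj y w → f w = f x := by
    intro y hy w hw
    have h0 := congrFun h y
    rw [fire_apply, add_eq_left] at h0
    have := (Finset.sum_eq_zero_iff_of_nonpos (fun w _ => by
      have := hx w (Finset.mem_univ w)
      omega)).1 h0 w (by simpa using hw)
    omega
  have all : ∀ y, f y = f x := by
    intro y
    by_cases hy : x = y
    · rw [hy]
    · rcases hG x y hy with h1 | ⟨w, h1, h2⟩
      · exact step x rfl y h1
      · exact step w (step x rfl w h1) y h2.symm
  rw [all u, all v]

theorem fire_add (f g : V → ℤ) (D : Divisor V) :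
    fire G (f + g) D = fire G g (fire G f D) := by
  funext w
  simp only [fire_apply, Pi.add_apply, add_assoc, ← Finset.sum_add_distrib]
  congr 1
  exact Finset.sum_congr rfl fun u _ => by ring

/-- The last time, counted from one, before time `r` at which a vertex was fired. -/
noncomputable def lastFired (W : ℕ → Finset V) : ℕ → V → ℕ
  | 0, _ => 0
  | r + 1, v => if v ∈ W r then r + 1 else lastFired W r v

theorem lastFired_le (W : ℕ → Finset V) (r : ℕ) (v : V) : lastFired W r v ≤ r := by
  induction r with
  | zero => simp [lastFired]
  | succ r ih => simp only [lastFired]; split_ifs <;> omega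

theorem lastFired_pos {W : ℕ → Finset V} {r t : ℕ} {v : V} (ht : t < r) (hv : v ∈ W t) :
    0 < lastFired W r v := by
  induction r with
  | zero => omega
  | succ r ih =>
    simp only [lastFired]
    split_ifs with h
    · omega
    · refine ih (lt_of_le_of_ne (Nat.lt_succ_iff.1 ht) ?_)
      rintro rfl
      exact h hv

theorem mem_of_lastFired_eq {W : ℕ → Finset V} {r t : ℕ} {v : V}
    (h : lastFired W r v = t + 1) : v ∈ W t := by
  induction r with
  | zero => simp [lastFired] at h
  | succ r ih =>
    simp only [lastFired] at h
    split_ifs at h with h'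
    · rwa [show t = r by omega]
    · exact ih h

/-- A vertex holds a chip from every neighbor that was fired later. -/
theorem card_lastFired_le {E : ℕ → Divisor V} {W : ℕ → Finset V}
    (hE : ∀ r, E (r + 1) = fire G (once (W r)) (E r)) (hpos : ∀ r, Effective (E r)) (r : ℕ)
    {v : V} (hv : 0 < lastFired W r v) :
    (#{u ∈ nbrs G v | lastFired W r v < lastFired W r u} : ℤ) ≤ E r v := by
  induction r with
  | zero => simp [lastFired] at hv
  | succ r ih =>
    by_cases h : v ∈ W r
    · rw [Finset.card_eq_zero.2]
      · exact_mod_cast hpos (r + 1) v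
      · refine Finset.filter_eq_empty_iff.2 fun u _ => ?_
        have := lastFired_le W (r + 1) u
        simp only [lastFired, h, if_true] at this ⊢
        omega
    · have hv' : 0 < lastFired W r v := by simpa [lastFired, h] using hv
      rw [hE r, fire_once_of_notMem G _ h]
      have hsub : {u ∈ nbrs G v | lastFired W (r + 1) v < lastFired W (r + 1) u} ⊆
          {u ∈ nbrs G v | lastFired W r v < lastFired W r u} ∪ (nbrs G v ∩ W r) := by
        intro u hu
        simp only [lastFired, h, if_false, mem_filter, mem_union, mem_inter] at hu ⊢
        by_cases hu' : u ∈ W r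
        · exact Or.inr ⟨hu.1, hu'⟩
        · simp only [hu', if_false] at hu
          exact Or.inl hu
      have h1 := (Finset.card_le_card hsub).trans (Finset.card_union_le _ _)
      have h2 := ih hv'
      have h3 : (#{u ∈ nbrs G v | lastFired W (r + 1) v < lastFired W (r + 1) u} : ℤ) ≤
        #{u ∈ nbrs G v | lastFired W r v < lastFired W r u} + #(nbrs G v ∩ W r) := by
        exact_mod_cast h1
      linarith

/-- Both sides count the edges joining different values of `L`, once from the lower end and once
from the upper. -/
theorem sum_card_lt_eq_sum_card_gt (L : V → ℕ) :
    ∑ v, #{u ∈ nbrs G v | L v < L u} = ∑ v, #{u ∈ nbrs G v | L u < L v} := by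
  have h1 : ∀ v, #{u ∈ nbrs G v | L v < L u} = ∑ u, if G.Adj v u ∧ L v < L u then 1 else 0 := by
    intro v
    rw [← Finset.sum_filter, ← Finset.card_eq_sum_ones]
    congr 1
    ext; simp
  have h2 : ∀ v, #{u ∈ nbrs G v | L u < L v} = ∑ u, if G.Adj v u ∧ L u < L v then 1 else 0 := by
    intro v
    rw [← Finset.sum_filter, ← Finset.card_eq_sum_ones]
    congr 1
    ext; simp
  simp only [h1, h2]
  rw [Finset.sum_comm]
  refine Finset.sum_congr rfl fun u _ => Finset.sum_congr rfl fun v _ => ?_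
  simp only [G.adj_comm u v]

/-- By `card_lastFired_le` there is a chip for every edge whose ends were last fired at different
times. Every vertex is on at least two such edges, so there are at least as many of them as
vertices. -/
theorem card_le_degree_of_all_fired {E : ℕ → Divisor V} {W : ℕ → Finset V} {s : ℕ}
    (hE : ∀ r, E (r + 1) = fire G (once (W r)) (E r)) (hpos : ∀ r, Effective (E r))
    (hW : ∀ r, #(W r) ≤ s) (hdeg : ∀ v, s + 1 ≤ #(nbrs G v)) {r : ℕ}
    (hr : ∀ v, ∃ t < r, v ∈ W t) : (Fintype.card V : ℤ) ≤ degree (E r) := by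
  set L := lastFired W r with hL
  have hLpos : ∀ v, 0 < L v := fun v => by
    obtain ⟨t, ht, hv⟩ := hr v
    exact lastFired_pos ht hv
  have h1 : ∀ v, 2 ≤ #{u ∈ nbrs G v | L v < L u} + #{u ∈ nbrs G v | L u < L v} := by
    intro v
    obtain ⟨t, ht⟩ : ∃ t, L v = t + 1 := ⟨L v - 1, by have := hLpos v; omega⟩
    -- `v` and the neighbors sharing its last time lie in one fired set, so at most s − 1 of the at
    -- least s + 1 neighbors share it.
    have heq : #{u ∈ nbrs G v | L u = L v} + 1 ≤ s := by
      have hsub : insert v {u ∈ nbrs G v | L u = L v} ⊆ W t := by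
        intro u hu
        rcases Finset.mem_insert.1 hu with rfl | hu
        · exact mem_of_lastFired_eq ht
        · exact mem_of_lastFired_eq ((Finset.mem_filter.1 hu).2.trans ht)
      have := (Finset.card_le_card hsub).trans (hW t)
      rwa [Finset.card_insert_of_notMem (by simp)] at this
    have hcov : nbrs G v ⊆ {u ∈ nbrs G v | L v < L u} ∪ {u ∈ nbrs G v | L u < L v} ∪
        {u ∈ nbrs G v | L u = L v} := by
      intro u hu
      simp only [mem_union, mem_filter, hu, true_and]
      omega
    have h2 := Finset.card_le_card hcov
    have h3 := Finset.card_union_le ({u ∈ nbrs G v | L v < L u} ∪ {u ∈ nbrs G v | L u < L v})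
      {u ∈ nbrs G v | L u = L v}
    have h4 := Finset.card_union_le {u ∈ nbrs G v | L v < L u} {u ∈ nbrs G v | L u < L v}
    have h5 := hdeg v
    omega
  have h2 : 2 * Fintype.card V ≤ 2 * ∑ v, #{u ∈ nbrs G v | L v < L u} := by
    calc 2 * Fintype.card V = ∑ _v : V, 2 := by simp [mul_comm]
      _ ≤ ∑ v, (#{u ∈ nbrs G v | L v < L u} + #{u ∈ nbrs G v | L u < L v}) :=
        Finset.sum_le_sum fun v _ => h1 v
      _ = _ := by rw [Finset.sum_add_distrib, ← sum_card_lt_eq_sum_card_gt, two_mul]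
  have h3 : ((∑ v, #{u ∈ nbrs G v | L v < L u} : ℕ) : ℤ) ≤ degree (E r) := by
    push_cast
    exact Finset.sum_le_sum fun v _ => card_lastFired_le G hE hpos r (hLpos v)
  have h4 : Fintype.card V ≤ ∑ v, #{u ∈ nbrs G v | L v < L u} := by omega
  exact le_trans (by exact_mod_cast h4) h3

/-- With few chips, firing small sets stops at a divisor from which no small set can be fired. -/
theorem exists_no_small_legal (hG : DiameterLeTwo G) {D : Divisor V} (hD : Effective D)
    {s : ℕ} (hdeg : ∀ v, s + 1 ≤ #(nbrs G v)) (hcard : degree D < Fintype.card V) :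
    ∃ D', Equivalent G D D' ∧ Effective D' ∧
      ∀ U : Finset V, U.Nonempty → Legal G D' U → s < #U := by
  -- Otherwise a small legal set can be fired forever. Only finitely many effective divisors have
  -- the given degree, so the sequence returns to an earlier divisor.
  by_contra! hcon
  let T := {D' : Divisor V // Equivalent G D D' ∧ Effective D'}
  have : Finite T := by
    refine Set.Finite.subset (Set.finite_Icc (0 : V → ℤ) (fun _ => degree D)) ?_
    rintro D' ⟨h1, h2⟩
    refine ⟨fun v => h2 v, fun v => ?_⟩
    rw [← h1.degree_eq]
    exact Finset.single_le_sum (fun w _ => h2 w) (Finset.mem_univ v)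
  choose U hU1 hU2 hU3 using fun t : T => hcon t.1 t.2.1 t.2.2
  let step : T → T := fun t => ⟨fire G (once (U t)) t.1,
    (equivalent_equivalence G).trans t.2.1 ⟨_, rfl⟩, (hU2 t).effective_fire G t.2.2⟩
  let seq : ℕ → T := fun r => step^[r] ⟨D, (equivalent_equivalence G).refl D, hD⟩
  have hseq : ∀ r, seq (r + 1) = step (seq r) := fun r => Function.iterate_succ_apply' _ _ _
  obtain ⟨i, j, hij, heq⟩ : ∃ i j, i < j ∧ seq i = seq j := by
    obtain ⟨i, j, hne, heq⟩ := Finite.exists_ne_map_eq_of_infinite seq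
    rcases lt_or_gt_of_ne hne with h | h
    · exact ⟨i, j, h, heq⟩
    · exact ⟨j, i, h, heq.symm⟩
  let E : ℕ → Divisor V := fun r => (seq (i + r)).1
  let W : ℕ → Finset V := fun r => U (seq (i + r))
  have hE : ∀ r, E (r + 1) = fire G (once (W r)) (E r) := by
    intro r
    simp only [E, W, ← add_assoc, hseq]
    rfl
  have hsum : ∀ r, E r = fire G (∑ t ∈ Finset.range r, once (W t)) (E 0) := by
    intro r
    induction r with
    | zero => funext w; simp [fire_apply]
    | succ r ih => rw [hE, Finset.sum_range_succ, fire_add, ← ih]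
  have hcyc : fire G (∑ t ∈ Finset.range (j - i), once (W t)) (E 0) = E 0 := by
    rw [← hsum]
    simp only [E, Nat.add_sub_cancel' hij.le, add_zero, heq]
  have hnn : ∀ t v, (0 : ℤ) ≤ once (W t) v := fun t v => by
    unfold once; split_ifs <;> norm_num
  obtain ⟨x, hx⟩ := hU1 (seq i)
  have hxpos : 0 < (∑ t ∈ Finset.range (j - i), once (W t)) x := by
    rw [Finset.sum_apply]
    refine Finset.sum_pos' (fun t _ => hnn t x) ⟨0, by simp; omega, ?_⟩
    have : x ∈ W 0 := hx
    simp [once, this]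
  -- The total script of the cycle fixes a divisor, so it is constant; as `x` was fired, every
  -- vertex was.
  have hr : ∀ v, ∃ t < j - i, v ∈ W t := by
    intro v
    by_contra! hv
    rw [eq_of_fire_eq_self G hG hcyc x v, Finset.sum_apply, Finset.sum_eq_zero] at hxpos
    · exact lt_irrefl _ hxpos
    · intro t ht
      simp [once, hv t (Finset.mem_range.1 ht)]
  have h1 := card_le_degree_of_all_fired G hE (fun r => (seq (i + r)).2.2)
    (fun r => hU3 (seq (i + r))) hdeg hr
  have h2 : degree (E (j - i)) = degree D := (seq (i + (j - i))).2.1.degree_eq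
  omega

end Termination

/-! ### From positive rank to maximum independent sets -/

section IndependentSets

open scoped Classical
open Finset

variable {V : Type*} [Fintype V] [DecidableEq V] {G : SimpleGraph V}

/-- Conditions under which the gonality is the number of vertices outside a maximum independent
set: edge cuts smaller than that number have a side with at most `s` vertices, while degrees and
numbers of common neighbors are large compared to `s`. -/
structure FiringDichotomy (G : SimpleGraph V) (s : ℕ) : Prop where
  small_of_cut : ∀ U : Finset V, U.Nonempty → Uᶜ.Nonempty →
    cut G U + G.indepNum ≤ Fintype.card V → #U ≤ s ∨ #Uᶜ ≤ s
  lt_degree : ∀ v, s + 1 ≤ #(nbrs G v)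
  common : s ≤ 1 ∨ ∀ u v, G.Adj u v → s + 3 ≤ #(nbrs G u ∩ nbrs G v)
  claw : ∀ u, ∀ I : Finset V, G.IsIndepSet I → I ⊆ nbrs G u → #I ≤ 4
  diameter : DiameterLeTwo G

theorem complDivisor_of_mem {S : Finset V} {v : V} (hv : v ∈ S) : complDivisor S v = 0 := by
  simp [complDivisor, hv]

theorem complDivisor_of_notMem {S : Finset V} {v : V} (hv : v ∉ S) : complDivisor S v = 1 := by
  simp [complDivisor, hv]

theorem effective_complDivisor (S : Finset V) : Effective (complDivisor S) := fun v => by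
  by_cases hv : v ∈ S
  · rw [complDivisor_of_mem hv]
  · rw [complDivisor_of_notMem hv]; norm_num

theorem complDivisor_le_one (S : Finset V) (v : V) : complDivisor S v ≤ 1 := by
  by_cases hv : v ∈ S
  · rw [complDivisor_of_mem hv]; norm_num
  · rw [complDivisor_of_notMem hv]

theorem degree_complDivisor (S : Finset V) :
    degree (complDivisor S) = Fintype.card V - #S := by
  have h : ∀ v, complDivisor S v = 1 - if v ∈ S then 1 else 0 := fun v => by
    by_cases hv : v ∈ S
    · simp [complDivisor_of_mem hv, hv]
    · simp [complDivisor_of_notMem hv, hv]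
  unfold degree
  simp [h, Finset.sum_sub_distrib]

theorem complDivisor_injective : Function.Injective (complDivisor : Finset V → Divisor V) := by
  intro S T h
  ext v
  have := congrFun h v
  by_cases hS : v ∈ S <;> by_cases hT : v ∈ T <;>
    simp_all [complDivisor_of_mem, complDivisor_of_notMem]

theorem exists_eq_single {E : Divisor V} (hE : Effective E) (h : degree E = 1) :
    ∃ v, E = Pi.single v 1 := by
  obtain ⟨v, hv⟩ : ∃ v, 1 ≤ E v := by
    by_contra! hcon
    have : degree E ≤ 0 := Finset.sum_nonpos fun v _ => by have := hcon v; omega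
    omega
  have h0 : ∀ w, 0 ≤ (E - Pi.single v 1 : Divisor V) w := fun w => by
    by_cases hw : w = v
    · subst hw; simpa using hv
    · simpa [hw] using hE w
  have h1 : degree (E - Pi.single v 1) = 0 := by rw [degree_sub, degree_single, h, sub_self]
  refine ⟨v, funext fun w => ?_⟩
  have := (Finset.sum_eq_zero_iff_of_nonneg fun w _ => h0 w).1 h1 w (Finset.mem_univ w)
  simpa [sub_eq_zero] using this

/-- To put a chip on v ∈ S, fire all other vertices: only neighbors of `v` lose a chip, and by
independence each of them has one. -/
theorem rankAtLeast_one_complDivisor {S : Finset V} (hS : G.IsIndepSet S)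
    (hdeg : ∀ v, 1 ≤ #(nbrs G v)) : RankAtLeast G (complDivisor S) 1 := by
  intro E hE h1
  obtain ⟨v, rfl⟩ := exists_eq_single hE (by exact_mod_cast h1)
  by_cases hv : v ∈ S
  · refine ⟨_, ⟨once {v}ᶜ, rfl⟩, fun w => ?_⟩
    by_cases hw : w = v
    · subst hw
      rw [fire_once_of_notMem G _ (by simp), Finset.inter_eq_left.2 (fun u hu => by
        have := (mem_nbrs G).1 hu
        simpa using this.ne')]
      have := hdeg w
      simp only [Pi.sub_apply, complDivisor_of_mem hv, Pi.single_eq_same]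
      omega
    · rw [fire_once_of_mem G _ (by simpa using hw)]
      simp only [Pi.sub_apply, Pi.single_apply, hw, if_false, sub_zero, sdiff_compl]
      by_cases hwv : G.Adj w v
      · have hwS : w ∉ S := fun h => hS h hv hw hwv
        rw [complDivisor_of_notMem hwS]
        have : #(nbrs G w ⊓ {v}) ≤ 1 :=
          (Finset.card_le_card Finset.inter_subset_right).trans (by simp)
        omega
      · have : nbrs G w ⊓ {v} = ∅ := by
          ext x
          simp only [inf_eq_inter, mem_inter, mem_nbrs, mem_singleton, notMem_empty, iff_false]
          rintro ⟨h, rfl⟩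
          exact hwv h
        rw [this]
        simpa using effective_complDivisor S w
  · refine ⟨_, (equivalent_equivalence G).refl _, fun w => ?_⟩
    by_cases hw : w = v
    · subst hw
      simp [complDivisor_of_notMem hv]
    · simpa [hw] using effective_complDivisor S w

namespace FiringDichotomy

variable {s : ℕ}

/-- The set of vertices kept back by a legal move that brings a chip to the zero `z`. -/
theorem exists_small_complement (h : FiringDichotomy G s) {D : Divisor V} (hD : Effective D)
    (hr : RankAtLeast G D 1) (hdeg : degree D + G.indepNum ≤ Fintype.card V)
    (hsp : ∀ U : Finset V, U.Nonempty → Legal G D U → s < #U) {z : V} (hz : D z = 0) :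
    ∃ W : Finset V, z ∈ W ∧ #W ≤ s ∧ (∀ y, D y = 0 → G.Adj z y → y ∈ W) ∧
      ∀ u ∉ W, (#(nbrs G u ∩ W) : ℤ) ≤ D u := by
  obtain ⟨D', ⟨f, rfl⟩, hD'⟩ := hr (Pi.single z 1) (effective_single z zero_le_one)
    (by rw [degree_single]; rfl)
  have hfire : ∀ w, fire G f D w = fire G f (D - Pi.single z 1) w +
      (Pi.single z 1 : Divisor V) w := by
    intro w
    simp only [fire_apply, Pi.sub_apply]
    ring
  obtain ⟨U, hU, hzU, hleg, -⟩ := exists_legal_of_fire G (D := D) (f := f) (z := z)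
    (fun w => by
      rw [hfire]
      exact add_nonneg (hD' w) (effective_single z zero_le_one w))
    (by rw [hfire, hz, Pi.single_eq_same]; linarith [hD' z])
  refine ⟨Uᶜ, by simpa using hzU, ?_, ?_, fun u hu => hleg.compl_apply G hu⟩
  · have hc := hleg.cut_le_degree G hD
    -- A legal move pays one chip per cut edge, so the cut is at most the degree. The fired side
    -- cannot be the small one by `hsp`.
    rcases h.small_of_cut U hU ⟨z, by simpa using hzU⟩ (by omega) with h1 | h1
    · exact absurd (hsp U hU hleg) (by omega)
    · exact h1
  -- A zero adjacent to `z` has no chip to send to `z`, so it cannot be fired.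
  · intro y hy hzy
    by_contra hyU
    have h1 := hleg y (by simpa using hyU)
    rw [hy] at h1
    have h2 : z ∈ nbrs G y \ U := by simp [hzy.symm, hzU]
    have := Finset.card_pos.2 ⟨z, h2⟩
    omega

/-- Discharging: each zero outside a largest independent set `I` of zeros forces surplus chips on
common neighbors with an element of `I`, more than the degree bound permits. -/
theorem eq_complDivisor (h : FiringDichotomy G s) {D : Divisor V} (hD : Effective D)
    (hr : RankAtLeast G D 1) (hdeg : degree D + G.indepNum ≤ Fintype.card V)
    (hsp : ∀ U : Finset V, U.Nonempty → Legal G D U → s < #U) :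
    ∃ S, G.IsMaximumIndepSet S ∧ D = complDivisor S := by
  set Z : Finset V := {v | D v = 0} with hZ
  have hmemZ : ∀ v, v ∈ Z ↔ D v = 0 := by simp [hZ]
  choose! W hWz hWs hWN hWD using fun z hz =>
    h.exists_small_complement hD hr hdeg hsp (z := z) hz
  obtain ⟨I, hI, hImax⟩ := Finset.exists_max_image
    (Z.powerset.filter fun I : Finset V => G.IsIndepSet (I : Set V)) Finset.card ⟨∅, by simp⟩
  simp only [mem_filter, mem_powerset] at hI hImax
  obtain ⟨hIZ, hIind⟩ := hI
  -- A zero with no neighbor in `I` could be added to `I`.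
  have hp : ∀ z, z ∈ Z \ I → ∃ i ∈ I, G.Adj i z := by
    intro z hz
    obtain ⟨hzZ, hzI⟩ := Finset.mem_sdiff.1 hz
    by_contra! hcon
    have h1 := hImax (insert z I) ⟨Finset.insert_subset hzZ hIZ, by
      rw [Finset.coe_insert, SimpleGraph.IsIndepSet, Set.pairwise_insert]
      exact ⟨hIind, fun i hi _ => ⟨fun hzi => hcon i hi hzi.symm, hcon i hi⟩⟩⟩
    rw [Finset.card_insert_of_notMem hzI] at h1
    omega
  choose! p hpI hpadj using hp
  set ex : V → ℕ := fun u => (D u - 1).toNat with hex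
  have hI0 : ∀ i ∈ I, D i = 0 := fun i hi => (hmemZ i).1 (hIZ hi)
  have hmain : 5 * #(Z \ I) ≤ 4 * ∑ u, ex u := by
    -- If s ≤ 1, then `W (p z)` is just `{p z}`, yet it contains the adjacent zero `z`; so there is
    -- no such `z`.
    rcases h.common with hs | hcom
    · have : Z \ I = ∅ := by
        refine Finset.eq_empty_of_forall_notMem fun z hz => ?_
        have h0 := hI0 _ (hpI z hz)
        have h1 := hWN (p z) h0 z ((hmemZ z).1 (Finset.mem_sdiff.1 hz).1) (hpadj z hz)
        have h2 := Finset.card_le_one.1 ((hWs (p z) h0).trans hs) z h1 _ (hWz (p z) h0)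
        exact (hpadj z hz).ne h2.symm
      simp [this]
    · let C : V → V → Prop := fun z u => u ∈ (nbrs G (p z) ∩ nbrs G z) \ W (p z)
      -- Of the at least s + 3 common neighbors, at most s − 2 lie in `W (p z)`, since that set also
      -- contains `z` and `p z`.
      have h5 : ∀ z ∈ Z \ I, 5 ≤ #(Finset.univ.bipartiteAbove C z) := by
        intro z hz
        have h0 := hI0 _ (hpI z hz)
        have h1 := hcom _ _ (hpadj z hz)
        have hzW := hWN (p z) h0 z ((hmemZ z).1 (Finset.mem_sdiff.1 hz).1) (hpadj z hz)
        have hne := (hpadj z hz).ne'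
        have h2 : nbrs G (p z) ∩ nbrs G z ⊆
            Finset.univ.bipartiteAbove C z ∪ ((W (p z)).erase (p z)).erase z := by
          intro u hu
          have hu' := Finset.mem_inter.1 hu
          simp only [mem_nbrs] at hu'
          simp only [mem_union, mem_erase, Finset.mem_bipartiteAbove, mem_univ, true_and, C,
            mem_sdiff]
          by_cases huW : u ∈ W (p z)
          · exact Or.inr ⟨hu'.2.ne', hu'.1.ne', huW⟩
          · exact Or.inl ⟨hu, huW⟩
        have h3 := (Finset.card_le_card h2).trans (Finset.card_union_le _ _)
        rw [Finset.card_erase_of_mem (Finset.mem_erase.2 ⟨hne, hzW⟩),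
          Finset.card_erase_of_mem (hWz _ h0)] at h3
        have h4 := hWs _ h0
        have h6 : 2 ≤ #(W (p z)) := Finset.one_lt_card.2 ⟨z, hzW, p z, hWz _ h0, hne⟩
        omega
      have h4 : ∀ u ∈ Finset.univ, #((Z \ I).bipartiteBelow C u) ≤ 4 * ex u := by
        intro u _
        set J : Finset V := {i ∈ I | u ∈ nbrs G i \ W i} with hJ
        have hJ4 : #J ≤ 4 := by
          refine h.claw u J (hIind.mono (by rw [hJ]; exact_mod_cast Finset.filter_subset _ _)) fun i hi => ?_
          simp only [hJ, mem_filter, mem_sdiff, mem_nbrs] at hi ⊢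
          exact hi.2.1.symm
        have hmaps : ∀ z ∈ (Z \ I).bipartiteBelow C u, p z ∈ J := by
          intro z hz
          simp only [Finset.mem_bipartiteBelow, C, mem_sdiff, mem_inter] at hz
          simp only [hJ, mem_filter, mem_sdiff]
          exact ⟨hpI z (by simpa using hz.1), hz.2.1.1, hz.2.2⟩
        -- `u` must send a chip to `i` and to each of these zeros, all of which lie in `W i`. The
        -- chip for `i` is the one not counted in `ex u`.
        have hfib : ∀ i ∈ J, #{z ∈ (Z \ I).bipartiteBelow C u | p z = i} ≤ ex u := by
          intro i hi
          simp only [hJ, mem_filter, mem_sdiff, mem_nbrs] at hi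
          obtain ⟨hiI, hui, huW⟩ := hi
          have h0 := hI0 i hiI
          have hsub : insert i {z ∈ (Z \ I).bipartiteBelow C u | p z = i} ⊆
              nbrs G u ∩ W i := by
            intro z hz
            rcases Finset.mem_insert.1 hz with rfl | hz
            · simp [hui.symm, hWz z h0]
            · simp only [mem_filter, Finset.mem_bipartiteBelow, C] at hz
              obtain ⟨⟨hz1, hz2⟩, rfl⟩ := hz
              have hz3 := (Finset.mem_inter.1 (Finset.mem_sdiff.1 hz2).1).2
              simp only [mem_inter, mem_nbrs] at hz3 ⊢
              exact ⟨hz3.symm, hWN _ h0 z ((hmemZ z).1 (Finset.mem_sdiff.1 hz1).1) (hpadj z hz1)⟩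
          have hcard := Finset.card_le_card hsub
          rw [Finset.card_insert_of_notMem] at hcard
          · have := hWD i h0 u huW
            simp only [hex]
            omega
          · intro hmem
            simp only [mem_filter, Finset.mem_bipartiteBelow, mem_sdiff] at hmem
            exact hmem.1.1.2 hiI
        calc _ ≤ ex u * #J := Finset.card_le_mul_card_image_of_maps_to hmaps _ hfib
          _ ≤ 4 * ex u := by rw [mul_comm]; exact Nat.mul_le_mul_right _ hJ4
      calc 5 * #(Z \ I) = ∑ z ∈ Z \ I, 5 := by simp [mul_comm]
        _ ≤ ∑ z ∈ Z \ I, #(Finset.univ.bipartiteAbove C z) := Finset.sum_le_sum h5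
        _ = ∑ u, #((Z \ I).bipartiteBelow C u) :=
          Finset.sum_card_bipartiteAbove_eq_sum_card_bipartiteBelow C
        _ ≤ ∑ u, 4 * ex u := Finset.sum_le_sum h4
        _ = 4 * ∑ u, ex u := by rw [Finset.mul_sum]
  have hsum : degree D = Fintype.card V - #Z + ((∑ u, ex u : ℕ) : ℤ) := by
    have hpt : ∀ u, D u = 1 - (if u ∈ Z then 1 else 0) + (ex u : ℤ) := by
      intro u
      have h0 := hD u
      by_cases hu : u ∈ Z
      · have := (hmemZ u).1 hu
        simp [hu, hex, this]
      · have : D u ≠ 0 := fun h => hu ((hmemZ u).2 h)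
        simp only [hu, if_false, hex]
        omega
    unfold degree
    rw [Finset.sum_congr rfl fun u _ => hpt u]
    simp [Finset.sum_add_distrib, Finset.sum_sub_distrib]
  have hIα : #I ≤ G.indepNum := hIind.card_le_indepNum
  have hcardZ : #(Z \ I) + #I = #Z := Finset.card_sdiff_add_card_eq_card hIZ
  -- The degree bound gives ∑ ex + α ≤ |Z| ≤ α + |Z \ I|; with 5|Z \ I| ≤ 4 ∑ ex both quantities are
  -- zero, and then |I| = α.
  have hZI : Z = I := by
    have : #(Z \ I) = 0 := by omega
    exact (Finset.sdiff_eq_empty_iff_subset.1 (Finset.card_eq_zero.1 this)).antisymm hIZ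
  have hex0 : ∑ u, ex u = 0 := by omega
  refine ⟨Z, ⟨by rw [hZI]; exact hIind, fun t ht => ?_⟩, funext fun v => ?_⟩
  · have := ht.card_le_indepNum
    omega
  · have hv := (Finset.sum_eq_zero_iff.1 hex0) v (Finset.mem_univ v)
    have h0 := hD v
    by_cases hvZ : v ∈ Z
    · rw [complDivisor_of_mem hvZ, (hmemZ v).1 hvZ]
    · have : D v ≠ 0 := fun h => hvZ ((hmemZ v).2 h)
      rw [complDivisor_of_notMem hvZ]
      simp only [hex] at hv
      omega

theorem indepNum_pos [Nonempty V] : 0 < G.indepNum := by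
  obtain ⟨v⟩ := ‹Nonempty V›
  have : G.IsIndepSet (({v} : Finset V) : Set V) := by simp
  simpa using Nat.lt_of_succ_le this.card_le_indepNum

theorem exists_equivalent_complDivisor [Nonempty V] (h : FiringDichotomy G s) {D : Divisor V}
    (hr : RankAtLeast G D 1) (hdeg : degree D + G.indepNum ≤ Fintype.card V) :
    ∃ S, G.IsMaximumIndepSet S ∧ Equivalent G D (complDivisor S) := by
  have hw : Winnable G D := by
    simpa using (hr.of_succ G) 0 (fun _ => le_rfl) (by simp [degree])
  obtain ⟨D₁, h1, hD₁⟩ := hw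
  have hα := indepNum_pos (G := G)
  obtain ⟨D₂, h2, hD₂, hsp⟩ := exists_no_small_legal G h.diameter hD₁ h.lt_degree
    (by rw [h1.degree_eq]; omega)
  have h12 := (equivalent_equivalence G).trans h1 h2
  obtain ⟨S, hS, rfl⟩ := h.eq_complDivisor hD₂ (hr.of_equivalent G h12)
    (by rw [h12.degree_eq]; exact hdeg) hsp
  exact ⟨S, hS, h12⟩

/-- The most-fired set `U` of a script from one divisor to the other is legal, so `U` or its
complement is small. As no vertex holds more than one chip before or after, neither case is
possible. -/
theorem eq_of_equivalent (h : FiringDichotomy G s) {S T : Finset V} (hS : G.IsMaximumIndepSet S)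
    (hST : Equivalent G (complDivisor S) (complDivisor T)) : S = T := by
  by_contra hne
  have hdeg := hST.degree_eq
  obtain ⟨f, hf⟩ := hST
  obtain ⟨z, hz⟩ : ∃ z, complDivisor S z < complDivisor T z := by
    by_contra! hcon
    refine hne (complDivisor_injective (funext fun v => ?_))
    exact ((Finset.sum_eq_sum_iff_of_le fun v _ => hcon v).1 hdeg v (Finset.mem_univ v)).symm
  obtain ⟨U, hU, hzU, hleg, M, hM, hlt⟩ := exists_legal_of_fire G (D := complDivisor S) (f := f)
    (z := z) (hf ▸ effective_complDivisor T) (hf ▸ hz)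
  have hcut := hleg.cut_le_degree G (effective_complDivisor S)
  rw [degree_complDivisor, SimpleGraph.maximumIndepSet_card_eq_indepNum S hS] at hcut
  have hzc : z ∈ Uᶜ := by simpa using hzU
  rcases h.small_of_cut U hU ⟨z, hzc⟩ (by omega) with hs | hs
  -- For small `U`, a vertex of `U` has at least two neighbors outside, but only one chip.
  · obtain ⟨u, hu⟩ := hU
    have h1 := (hleg u hu).trans (complDivisor_le_one S u)
    have h2 := h.lt_degree u
    have h3 := Finset.card_sdiff_add_card_inter (nbrs G u) U
    have h4 : #(nbrs G u ∩ U) ≤ #(U.erase u) := Finset.card_le_card fun w hw => by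
      obtain ⟨hw1, hw2⟩ := Finset.mem_inter.1 hw
      exact Finset.mem_erase.2 ⟨((mem_nbrs G).1 hw1).ne', hw2⟩
    have h5 := Finset.card_erase_add_one hu
    omega
  · have hone : ∀ u ∈ U, ∀ x ∈ Uᶜ, ∀ y ∈ Uᶜ, G.Adj u x → G.Adj u y → x = y := by
      intro u hu x hx y hy hux huy
      have h1 := (hleg.compl_apply G (u := u) (by simpa using hu)).trans (complDivisor_le_one S u)
      exact Finset.card_le_one.1 (by exact_mod_cast h1) x (by simp_all) y (by simp_all)
    -- Adjacent `z` and `y` have more common neighbors than `Uᶜ` has elements; one in `U` would have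
    -- to send two chips.
    have hadj : ∀ y ∈ Uᶜ, ¬ G.Adj z y := by
      intro y hy hzy
      have h2 : 2 ≤ #Uᶜ := Finset.one_lt_card.2 ⟨z, hzc, y, hy, hzy.ne⟩
      have h3 := (h.common.resolve_left (by omega)) z y hzy
      obtain ⟨w, hw, hwU⟩ := Finset.exists_mem_notMem_of_card_lt_card
        (show #Uᶜ < #(nbrs G z ∩ nbrs G y) by omega)
      simp only [mem_inter, mem_nbrs] at hw
      exact hzy.ne (hone w (by simpa using hwU) z hzc y hy hw.1.symm hw.2.symm)
    -- By diameter two, another vertex of `Uᶜ` would be adjacent to `z` or share a neighbor with it.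
    -- So `Uᶜ` is `{z}`, and `z` receives at least deg z ≥ 2 chips, too many for the target divisor.
    have hall : ∀ y, y ≠ z → f y = M := by
      intro y hy
      refine hM y ?_
      by_contra hyU
      have hyc : y ∈ Uᶜ := by simpa using hyU
      rcases h.diameter z y hy.symm with h1 | ⟨w, h1, h2⟩
      · exact hadj y hyc h1
      · by_cases hwU : w ∈ U
        · exact hy (hone w hwU y hyc z hzc h2.symm h1.symm)
        · exact hadj w (by simpa using hwU) h1
    have hval := congrFun hf z
    rw [fire_apply, Finset.sum_congr rfl (g := fun _ => M - f z) (fun u hu => by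
      rw [hall u ((mem_nbrs G).1 hu).ne'])] at hval
    rw [Finset.sum_const, nsmul_eq_mul] at hval
    have h1 := complDivisor_le_one T z
    have h2 := effective_complDivisor S z
    have h3 := h.lt_degree z
    have h4 := hlt z hzU
    have h5 : 1 ≤ #Uᶜ := Finset.card_pos.2 ⟨z, hzc⟩
    have h6 : (#(nbrs G z) : ℤ) ≤ #(nbrs G z) * (M - f z) :=
      le_mul_of_one_le_right (by positivity) (by omega)
    omega

theorem degree_of_isMaximumIndepSet {S : Finset V} (hS : G.IsMaximumIndepSet S) :
    degree (complDivisor S) = ((Fintype.card V - G.indepNum : ℕ) : ℤ) := by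
  have hα := SimpleGraph.maximumIndepSet_card_eq_indepNum S hS
  rw [degree_complDivisor, ← hα, Nat.cast_sub (Finset.card_le_univ S)]

theorem gonality_eq [Nonempty V] (h : FiringDichotomy G s) :
    gonality G = Fintype.card V - G.indepNum := by
  obtain ⟨S, hS⟩ := SimpleGraph.maximumIndepSet_exists (G := G)
  have hmem : Fintype.card V - G.indepNum ∈
      {d : ℕ | ∃ D : Divisor V, degree D = d ∧ 0 < rank G D} :=
    ⟨complDivisor S, degree_of_isMaximumIndepSet hS, rank_pos_of_rankAtLeast_one G
      (rankAtLeast_one_complDivisor hS.isIndepSet fun v => by have := h.lt_degree v; omega)⟩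
  refine le_antisymm (Nat.sInf_le hmem) (le_csInf ⟨_, hmem⟩ ?_)
  rintro d ⟨D, hd, hr⟩
  by_contra hlt
  obtain ⟨T, hT, hDT⟩ := h.exists_equivalent_complDivisor (rankAtLeast_one_of_rank_pos G hr)
    (by omega)
  have := hDT.degree_eq
  rw [degree_of_isMaximumIndepSet hT] at this
  omega

/-- If the rank were at least 2, removing a chip would leave positive rank in a degree below N − α.
-/
theorem rank_complDivisor [Nonempty V] (h : FiringDichotomy G s) {S : Finset V}
    (hS : G.IsMaximumIndepSet S) : rank G (complDivisor S) = 1 := by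
  have h1 := rank_pos_of_rankAtLeast_one G
    (rankAtLeast_one_complDivisor hS.isIndepSet fun v => by have := h.lt_degree v; omega)
  have h2 := rank_le_one_of_not_rankAtLeast_two G (D := complDivisor S) fun h2 => by
    obtain ⟨v⟩ := ‹Nonempty V›
    have hd : degree (complDivisor S - Pi.single v 1) =
        ((Fintype.card V - G.indepNum : ℕ) : ℤ) - 1 := by
      rw [degree_sub, degree_single, degree_of_isMaximumIndepSet hS]
    have hα : G.indepNum ≤ Fintype.card V := by
      rw [← SimpleGraph.maximumIndepSet_card_eq_indepNum S hS]
      exact Finset.card_le_univ S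
    obtain ⟨T, hT, hDT⟩ := h.exists_equivalent_complDivisor (h2.sub_single G v) (by omega)
    have := hDT.degree_eq
    rw [degree_of_isMaximumIndepSet hT] at this
    omega
  omega

theorem bijOn_divisorClass [Nonempty V] (h : FiringDichotomy G s) :
    Set.BijOn (fun S : Finset V => divisorClass G (complDivisor S))
      {S | G.IsMaximumIndepSet S}
      {c | ∃ D : Divisor V, divisorClass G D = c ∧ degree D = (gonality G : ℤ) ∧
        rank G D = 1} := by
  refine ⟨fun S hS => ?_, fun S hS T hT hST => ?_, ?_⟩
  · exact ⟨complDivisor S, rfl, by rw [h.gonality_eq, degree_of_isMaximumIndepSet hS],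
      h.rank_complDivisor hS⟩
  · exact h.eq_of_equivalent hS (Quotient.exact hST)
  · rintro _ ⟨D, rfl, hdeg, hrank⟩
    have hα : G.indepNum ≤ Fintype.card V := by
      obtain ⟨S, hS⟩ := SimpleGraph.maximumIndepSet_exists (G := G)
      rw [← SimpleGraph.maximumIndepSet_card_eq_indepNum S hS]
      exact Finset.card_le_univ S
    obtain ⟨S, hS, hDS⟩ := h.exists_equivalent_complDivisor (D := D)
      (rankAtLeast_one_of_rank_pos G (by omega)) (by rw [hdeg, h.gonality_eq]; omega)
    exact ⟨S, hS, Quotient.sound ((equivalent_equivalence G).symm hDS)⟩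

end FiringDichotomy

end IndependentSets

/-! ### A lower bound for edge cuts from degrees -/

section CutBounds

open Finset

variable {V : Type*} [Fintype V] [DecidableEq V] (G : SimpleGraph V)

/-- Each closed neighborhood has at least `M` elements, at most |U| of them in `U`. This is the
effective bound for small `U`. -/
theorem card_mul_le_cut_add {M : ℕ} (hM : ∀ v, M ≤ #(nbrs G v) + 1) (U : Finset V) :
    #U * M ≤ cut G U + #U * #U := by
  have h : ∀ u ∈ U, M ≤ #(nbrs G u \ U) + #U := by
    intro u hu
    have h1 := hM u
    have h2 := Finset.card_sdiff_add_card_inter (nbrs G u) U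
    have h3 : #(nbrs G u ∩ U) ≤ #(U.erase u) := Finset.card_le_card fun w hw => by
      obtain ⟨hw1, hw2⟩ := Finset.mem_inter.1 hw
      exact Finset.mem_erase.2 ⟨((mem_nbrs G).1 hw1).ne', hw2⟩
    have h4 := Finset.card_erase_add_one hu
    omega
  calc #U * M = ∑ u ∈ U, M := by simp
    _ ≤ ∑ u ∈ U, (#(nbrs G u \ U) + #U) := Finset.sum_le_sum h
    _ = _ := by simp [cut, Finset.sum_add_distrib]

theorem cut_eq_card (U : Finset V) :
    cut G U = #(U.sigma fun u => nbrs G u \ U) := by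
  simp [cut]

end CutBounds

/-! ### Abstract queen's graphs: lines, degrees and cuts -/

section QueenGraph

open Finset

variable {X Y R : Type*} [Fintype X] [Fintype Y] [Fintype R] [DecidableEq X] [DecidableEq Y]
  [DecidableEq R] [AddCommGroup R]

/-- Vertices are adjacent if they are in the same row, column, diagonal or antidiagonal, where the
diagonals are the fibers of the difference and of the sum of two maps to a common group. -/
structure IsQueenGraph (G : SimpleGraph (X × Y)) (A : X → R) (B : Y → R) (a b : ℕ) : Prop where
  adj_iff : ∀ p q, G.Adj p q ↔ p ≠ q ∧ (p.1 = q.1 ∨ p.2 = q.2 ∨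
    A p.1 - B p.2 = A q.1 - B q.2 ∨ A p.1 + B p.2 = A q.1 + B q.2)
  card_fst : ∀ r, #{x | A x = r} = a
  card_snd : ∀ r, #{y | B y = r} = b

theorem card_eq_of_card_fiber {A : X → R} {a : ℕ} (hA : ∀ r, #{x | A x = r} = a) :
    Fintype.card X = Fintype.card R * a := by
  rw [← Finset.card_univ, Finset.card_eq_sum_card_fiberwise (f := A) (t := Finset.univ)
    (fun x _ => Finset.mem_univ _)]
  simp [hA]

theorem card_sum_eq {A : X → R} {B : Y → R} {a b : ℕ} (hA : ∀ r, #{x | A x = r} = a)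
    (hB : ∀ r, #{y | B y = r} = b) (c : R) :
    #{q : X × Y | A q.1 + B q.2 = c} = Fintype.card R * a * b := by
  rw [← card_eq_of_card_fiber hA, Finset.card_eq_sum_card_fiberwise (f := Prod.fst)
    (t := Finset.univ) (fun x _ => Finset.mem_univ _), Finset.sum_congr rfl (g := fun _ => b)]
  · simp
  · intro x _
    rw [← hB (c - A x)]
    refine Finset.card_bij (fun q _ => q.2) ?_ ?_ ?_
    · rintro ⟨x', y⟩ h
      simp only [mem_filter, mem_univ, true_and] at h ⊢
      rw [← h.1, h.2]; abel
    · rintro ⟨x₁, y₁⟩ h₁ ⟨x₂, y₂⟩ h₂ h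
      simp only [mem_filter, mem_univ, true_and] at h₁ h₂
      ext
      · exact h₁.2.trans h₂.2.symm
      · exact h
    · intro y hy
      simp only [mem_filter, mem_univ, true_and] at hy
      exact ⟨(x, y), by simp [hy], rfl⟩

theorem card_neg_fiber {B : Y → R} {b : ℕ} (hB : ∀ r, #{y | B y = r} = b) (r : R) :
    #{y | (-B) y = r} = b := by
  rw [← hB (-r)]
  congr 1
  ext y
  simp [neg_eq_iff_eq_neg]

namespace IsQueenGraph

variable {G : SimpleGraph (X × Y)} {A : X → R} {B : Y → R} {a b : ℕ}

theorem card_fst_type (h : IsQueenGraph G A B a b) : Fintype.card X = Fintype.card R * a :=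
  card_eq_of_card_fiber h.card_fst

theorem card_snd_type (h : IsQueenGraph G A B a b) : Fintype.card Y = Fintype.card R * b :=
  card_eq_of_card_fiber h.card_snd

theorem card_diagonal (h : IsQueenGraph G A B a b) (c : R) :
    #{q : X × Y | A q.1 - B q.2 = c} = Fintype.card R * a * b := by
  rw [← card_sum_eq h.card_fst (card_neg_fiber h.card_snd) c]
  simp [sub_eq_add_neg]

theorem diameterLeTwo (h : IsQueenGraph G A B a b) : DiameterLeTwo G := by
  intro p q hpq
  by_cases h1 : p.1 = q.1
  · exact Or.inl ((h.adj_iff p q).2 ⟨hpq, Or.inl h1⟩)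
  by_cases h2 : p.2 = q.2
  · exact Or.inl ((h.adj_iff p q).2 ⟨hpq, Or.inr (Or.inl h2)⟩)
  refine Or.inr ⟨(p.1, q.2), (h.adj_iff _ _).2 ⟨fun e => h2 ?_, Or.inl rfl⟩,
    (h.adj_iff _ _).2 ⟨fun e => h1 ?_, Or.inr (Or.inl rfl)⟩⟩
  · rw [e]
  · rw [e]

/-- The four lines through `u` are cliques covering its neighbors, so each contains at most one
element of `I`. -/
theorem card_independent_neighbors_le (h : IsQueenGraph G A B a b) (u : X × Y)
    (I : Finset (X × Y)) (hI : G.IsIndepSet I) (hu : I ⊆ nbrs G u) : #I ≤ 4 := by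
  let f : X × Y → Fin 4 := fun q => if q.1 = u.1 then 0 else if q.2 = u.2 then 1 else
    if A q.1 - B q.2 = A u.1 - B u.2 then 2 else 3
  have := Finset.card_le_card_of_injOn (s := I) (t := Finset.univ) f (fun _ _ => by simp) ?_
  · simpa using this
  · intro p hp q hq hf
    by_contra hpq
    have hnot : ¬ G.Adj p q := hI hp hq hpq
    rw [h.adj_iff] at hnot
    have h1 := ((h.adj_iff _ _).1 ((mem_nbrs G).1 (hu hp))).2
    have h2 := ((h.adj_iff _ _).1 ((mem_nbrs G).1 (hu hq))).2
    simp only [f] at hf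
    grind

/-- A lower bound for the number of vertices that are equal or adjacent to a given one. -/
theorem le_card_nbrs (h : IsQueenGraph G A B a b) {z : ℕ} (hz : #{t : R | t + t = 0} ≤ z)
    (p : X × Y) :
    2 * (Fintype.card R * a * b) + Fintype.card R * a + Fintype.card R * b ≤
      #(nbrs G p) + 1 + z * (a * b) + a + b := by
  set D₁ : Finset (X × Y) := {q | A q.1 - B q.2 = A p.1 - B p.2} with hD₁
  set D₂ : Finset (X × Y) := {q | A q.1 + B q.2 = A p.1 + B p.2} with hD₂
  -- The row and column of `p` without the fibers of `A` and `B` through `p`: what remains is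
  -- disjoint from both diagonals.
  set S : Finset (X × Y) := ({x | ¬ A x = A p.1} : Finset X) ×ˢ {p.2} with hS
  set T : Finset (X × Y) := {p.1} ×ˢ ({y | ¬ B y = B p.2} : Finset Y) with hT
  have c₁ : #D₁ = Fintype.card R * a * b := h.card_diagonal _
  have c₂ : #D₂ = Fintype.card R * a * b := card_sum_eq h.card_fst h.card_snd _
  have cS : #S + a = Fintype.card R * a := by
    rw [← h.card_fst_type, hS, Finset.card_product, Finset.card_singleton, mul_one,
      ← h.card_fst (A p.1), add_comm, Finset.card_filter_add_card_filter_not, Finset.card_univ]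
  have cT : #T + b = Fintype.card R * b := by
    rw [← h.card_snd_type, hT, Finset.card_product, Finset.card_singleton, one_mul,
      ← h.card_snd (B p.2), add_comm, Finset.card_filter_add_card_filter_not, Finset.card_univ]
  -- On both diagonals the offset t = A q.1 − A p.1 satisfies 2t = 0, and each such t accounts for
  -- at most ab vertices.
  have c₁₂ : #(D₁ ∩ D₂) ≤ z * (a * b) := by
    have h1 := Finset.card_le_mul_card_image_of_maps_to (s := D₁ ∩ D₂)
      (f := fun q => A q.1 - A p.1) (t := {t : R | t + t = 0}) ?_ (a * b) ?_
    · calc _ ≤ _ := h1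
        _ ≤ _ := by rw [mul_comm]; exact Nat.mul_le_mul_right _ hz
    · intro q hq
      simp only [hD₁, hD₂, mem_inter, mem_filter, mem_univ, true_and] at hq ⊢
      have h2 : A q.1 - A p.1 + (A q.1 - A p.1) =
        ((A q.1 - B q.2) - (A p.1 - B p.2)) + ((A q.1 + B q.2) - (A p.1 + B p.2)) := by abel
      rw [h2, hq.1, hq.2]; abel
    · intro t _
      have hsub : {q ∈ D₁ ∩ D₂ | A q.1 - A p.1 = t} ⊆
          ({x | A x = t + A p.1} : Finset X) ×ˢ ({y | B y = B p.2 - t} : Finset Y) := by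
        intro q hq
        simp only [hD₁, hD₂, mem_inter, mem_filter, mem_univ, true_and, mem_product] at hq ⊢
        obtain ⟨⟨-, h2⟩, rfl⟩ := hq
        refine ⟨by abel, ?_⟩
        calc B q.2 = (A q.1 + B q.2) - A q.1 := by abel
          _ = _ := by rw [h2]; abel
      have := Finset.card_le_card hsub
      rwa [Finset.card_product, h.card_fst, h.card_snd] at this
  have cST : #(S ∪ T) = #S + #T := by
    refine Finset.card_union_of_disjoint (Finset.disjoint_left.2 fun q hq hq' => ?_)
    simp only [hS, hT, mem_product, mem_filter, mem_univ, true_and, mem_singleton] at hq hq'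
    exact hq.1 (by rw [hq'.1])
  have cDS : #((D₁ ∪ D₂) ∪ (S ∪ T)) = #(D₁ ∪ D₂) + #(S ∪ T) := by
    refine Finset.card_union_of_disjoint (Finset.disjoint_left.2 fun q hq hq' => ?_)
    simp only [hS, hT, hD₁, hD₂, mem_union, mem_product, mem_filter, mem_univ, true_and,
      mem_singleton] at hq hq'
    rcases hq' with ⟨h1, h2⟩ | ⟨h1, h2⟩ <;> rcases hq with h3 | h3
    · rw [h2, sub_left_inj] at h3; exact h1 h3
    · rw [h2, add_left_inj] at h3; exact h1 h3
    · rw [h1, sub_right_inj] at h3; exact h2 h3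
    · rw [h1, add_right_inj] at h3; exact h2 h3
  have hsub : (D₁ ∪ D₂) ∪ (S ∪ T) ⊆ insert p (nbrs G p) := by
    intro q hq
    simp only [hS, hT, hD₁, hD₂, mem_union, mem_product, mem_filter, mem_univ, true_and,
      mem_singleton] at hq
    by_cases hqp : q = p
    · simp [hqp]
    · refine Finset.mem_insert_of_mem ((mem_nbrs G).2 ((h.adj_iff _ _).2 ⟨Ne.symm hqp, ?_⟩))
      rcases hq with (h1 | h1) | (⟨-, h1⟩ | ⟨h1, -⟩)
      · exact Or.inr (Or.inr (Or.inl h1.symm))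
      · exact Or.inr (Or.inr (Or.inr h1.symm))
      · exact Or.inr (Or.inl h1.symm)
      · exact Or.inl h1.symm
  have h1 := Finset.card_le_card hsub
  rw [Finset.card_insert_of_notMem (by simp)] at h1
  have h2 := Finset.card_union_add_card_inter D₁ D₂
  omega

/-- Each pair of vertices separated by `U` is joined by a path consisting of a row edge and a column
edge, one of which is cut. -/
theorem card_mul_card_compl_le (h : IsQueenGraph G A B a b) {k : ℕ} (hX : Fintype.card X ≤ k)
    (hY : Fintype.card Y ≤ k) (U : Finset (X × Y)) : #U * #Uᶜ ≤ k * cut G U := by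
  rw [cut_eq_card, ← Finset.card_product]
  -- The cut edge on the path through the corner `(q.1, p.2)`. A column edge leaves only the first
  -- coordinate of the start free, a row edge only the second coordinate of the end.
  let f : (X × Y) × (X × Y) → (_ : X × Y) × (X × Y) := fun e =>
    if (e.2.1, e.1.2) ∈ U then ⟨(e.2.1, e.1.2), e.2⟩ else ⟨e.1, (e.2.1, e.1.2)⟩
  refine Finset.card_le_mul_card_image_of_maps_to (f := f) ?_ _ ?_
  · rintro ⟨⟨x, y⟩, ⟨x', y'⟩⟩ he
    simp only [mem_product, mem_compl] at he
    simp only [f]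
    split_ifs with hU
    · simp only [mem_sigma, mem_sdiff, mem_nbrs]
      exact ⟨hU, (h.adj_iff _ _).2 ⟨fun e => he.2 (e ▸ hU), Or.inl rfl⟩, he.2⟩
    · simp only [mem_sigma, mem_sdiff, mem_nbrs]
      exact ⟨he.1, (h.adj_iff _ _).2 ⟨fun e => hU (e ▸ he.1), Or.inr (Or.inl rfl)⟩, hU⟩
  · rintro ⟨p, q⟩ hpq
    simp only [mem_sigma, mem_sdiff, mem_nbrs] at hpq
    have hne := hpq.2.1.ne
    by_cases h1 : p.1 = q.1
    · refine le_trans ?_ hX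
      rw [← Finset.card_univ]
      refine Finset.card_le_card_of_injOn (fun e => e.1.1) (fun _ _ => by simp) ?_
      rintro ⟨⟨x₁, y₁⟩, ⟨x₁', y₁'⟩⟩ he₁ ⟨⟨x₂, y₂⟩, ⟨x₂', y₂'⟩⟩ he₂ hee
      simp only [coe_filter, mem_product, mem_compl, Set.mem_ofPred_eq, f] at he₁ he₂ hee
      grind
    · refine le_trans ?_ hY
      rw [← Finset.card_univ]
      refine Finset.card_le_card_of_injOn (fun e => e.2.2) (fun _ _ => by simp) ?_
      rintro ⟨⟨x₁, y₁⟩, ⟨x₁', y₁'⟩⟩ he₁ ⟨⟨x₂, y₂⟩, ⟨x₂', y₂'⟩⟩ he₂ hee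
      simp only [coe_filter, mem_product, mem_compl, Set.mem_ofPred_eq, f] at he₁ he₂ hee
      grind

end IsQueenGraph

end QueenGraph

/-! ### Numerical estimates for the small side of a cut -/

section Arithmetic

/-- k(M − k) is concave in k, so a lower bound on an interval need only be checked at its ends. -/
theorem le_mul_sub_of_endpoints {M N k k₀ k₁ : ℝ} (h₀ : k₀ ≤ k) (h₁ : k ≤ k₁)
    (e₀ : N ≤ k₀ * (M - k₀)) (e₁ : N ≤ k₁ * (M - k₁)) : N ≤ k * (M - k) := by
  rcases h₀.eq_or_lt with rfl | h₀
  · exact e₀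
  have hpos : 0 < k₁ - k₀ := by linarith
  have key : (k₁ - k₀) * (k * (M - k) - N) = (k₁ - k) * (k₀ * (M - k₀) - N) +
      (k - k₀) * (k₁ * (M - k₁) - N) + (k - k₀) * (k₁ - k) * (k₁ - k₀) := by ring
  have h2 : 0 ≤ (k₁ - k₀) * (k * (M - k) - N) := by
    rw [key]
    have a1 := mul_nonneg (sub_nonneg.2 h₁) (sub_nonneg.2 e₀)
    have a2 := mul_nonneg (sub_pos.2 h₀).le (sub_nonneg.2 e₁)
    have a3 := mul_nonneg (mul_nonneg (sub_pos.2 h₀).le (sub_nonneg.2 h₁)) hpos.le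
    linarith
  have := nonneg_of_mul_nonneg_right h2 hpos
  linarith

theorem endpoint_of_le {d a b : ℝ} (hd : 3 ≤ d) (ha : 1 ≤ a) (hab : a ≤ b) :
    d * a * (d * b) ≤ 2 * (d * b) * ((d - 1) * (a + b + 2 * (a * b)) - 2 * (d * b)) := by
  have h1 : 0 ≤ (a - 1) * b := mul_nonneg (by linarith) (by linarith)
  have h2 : d * a ≤ 2 * ((d - 1) * (a + b + 2 * (a * b)) - 2 * (d * b)) := by
    nlinarith [mul_nonneg (sub_nonneg.2 hd) h1, mul_nonneg (sub_nonneg.2 hd) (by linarith : 0 ≤ b),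
      mul_nonneg (sub_nonneg.2 hd) (by linarith : 0 ≤ a)]
  have h3 : 0 ≤ d * b := by nlinarith
  nlinarith [mul_le_mul_of_nonneg_left h2 h3]

/-- Upper end of the interval excluded in `le_smallSide`; (d − 1)(a + b + 2ab) is a lower bound for
`M` there. -/
theorem endpoint_max {d a b : ℝ} (hd : 3 ≤ d) (ha : 1 ≤ a) (hb : 1 ≤ b) :
    d * a * (d * b) ≤ 2 * max (d * a) (d * b) *
      ((d - 1) * (a + b + 2 * (a * b)) - 2 * max (d * a) (d * b)) := by
  rcases le_total a b with h | h
  · rw [max_eq_right (mul_le_mul_of_nonneg_left h (by linarith))]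
    exact endpoint_of_le hd ha h
  · rw [max_eq_left (mul_le_mul_of_nonneg_left h (by linarith))]
    have := endpoint_of_le hd hb h
    nlinarith

/-- Lower end of that interval, just above (d + 1)/2. -/
theorem endpoint_low {d a b : ℝ} (hd : 2 ≤ d) (ha : 1 ≤ a) (hb : 1 ≤ b) :
    d * a * (d * b) ≤ (d + 2) / 2 * ((d - 1) * (a + b + 2 * (a * b)) - (d + 2) / 2) := by
  have h1 : 1 ≤ a * b := by nlinarith
  have h2 : 0 ≤ (d - 2) * (a * b) := mul_nonneg (by linarith) (by linarith)
  have h3 : 0 ≤ (d ^ 2 + d - 2) * (a + b - 2) := mul_nonneg (by nlinarith) (by linarith)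
  nlinarith

/-- The largest number of vertices on the small side of a small edge cut. -/
def smallSide (d a b : ℕ) : ℕ :=
  if d ≤ 3 ∨ (a = 1 ∧ b = 1 ∧ d ≤ 6) then 1 else (d + 1) / 2

/-- The path bound `h₂` excludes large k, and the degree bound `h₁` makes k(M − k) < N; by concavity
the latter fails throughout the range between `smallSide` and 2 max(da, db). -/
theorem le_smallSide {d a b k k' c z M : ℕ} (hd : 1 ≤ d) (ha : 1 ≤ a) (hb : 1 ≤ b)
    (hab : 4 ≤ d * a * (d * b))
    (hz : z ≤ 2) (hzodd : Odd d → z ≤ 1) (hN : k + k' = d * a * (d * b)) (hkk : k ≤ k')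
    (hc : c < d * a * (d * b))
    (hM : 2 * (d * a * b) + d * a + d * b = M + z * (a * b) + a + b)
    (h₁ : k * M ≤ c + k * k) (h₂ : k * k' ≤ max (d * a) (d * b) * c) : k ≤ smallSide d a b := by
  by_contra hk
  push Not at hk
  have hpos : 0 < k := by omega
  -- As k' ≥ N/2, k ≥ 2 max(da, db) would give kk' ≥ max(da, db) · N, contrary to `h₂`.
  have hlt : k < 2 * max (d * a) (d * b) := by
    by_contra! hcon
    have h3 := Nat.mul_le_mul_right k' hcon
    have h4 : 0 < max (d * a) (d * b) := lt_max_of_lt_left (by positivity)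
    have h5 := Nat.mul_lt_mul_of_pos_left hc h4
    have h6 := Nat.mul_le_mul_left (max (d * a) (d * b)) (show d * a * (d * b) ≤ 2 * k' by omega)
    nlinarith
  have rd : (1 : ℝ) ≤ d := by exact_mod_cast hd
  have ra : (1 : ℝ) ≤ a := by exact_mod_cast ha
  have rb : (1 : ℝ) ≤ b := by exact_mod_cast hb
  have rz : (z : ℝ) ≤ 2 := by exact_mod_cast hz
  have rab : (1 : ℝ) ≤ a * b := by nlinarith
  have rhalf : 2 * (k : ℝ) ≤ d * a * (d * b) := by exact_mod_cast (show 2 * k ≤ _ by omega)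
  have rlt : (k : ℝ) ≤ 2 * max ((d : ℝ) * a) (d * b) := by exact_mod_cast hlt.le
  have rM : (M : ℝ) = 2 * (d * a * b) + d * a + d * b - z * (a * b) - a - b := by
    have : (2 * (d * a * b) + d * a + d * b : ℝ) = M + z * (a * b) + a + b := by
      exact_mod_cast hM
    linarith
  have rM₀ : (d - 1 : ℝ) * (a + b + 2 * (a * b)) ≤ M := by
    rw [rM]
    nlinarith [mul_nonneg (sub_nonneg.2 rz) (by linarith : (0 : ℝ) ≤ a * b)]
  have rsmall : ¬ (d * a * (d * b) : ℝ) ≤ k * (M - k) := by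
    intro hcon
    have h3 : (c : ℝ) < d * a * (d * b) := by exact_mod_cast hc
    have h4 : (k * M : ℝ) ≤ c + k * k := by exact_mod_cast h₁
    nlinarith
  have rk : (0 : ℝ) ≤ k := by positivity
  by_cases hs : d ≤ 3 ∨ (a = 1 ∧ b = 1 ∧ d ≤ 6)
  · have hk2 : 2 ≤ k := by simp only [smallSide, hs, if_true] at hk; omega
    have rk2 : (2 : ℝ) ≤ k := by exact_mod_cast hk2
    have r4 : (4 : ℝ) ≤ d * a * (d * b) := by exact_mod_cast hab
    by_cases hd3 : d < 3
    -- `endpoint_max` needs d ≥ 3; for d = 1, 2 the upper end is N/2 instead.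
    · refine rsmall (le_mul_sub_of_endpoints rk2 (by linarith : (k : ℝ) ≤ d * a * (d * b) / 2) ?_ ?_)
      · interval_cases d
        · have rz1 : (z : ℝ) ≤ 1 := by exact_mod_cast hzodd odd_one
          have := mul_le_mul_of_nonneg_right rz1 (by linarith : (0 : ℝ) ≤ a * b)
          norm_num at r4 rM ⊢
          linarith
        · norm_num at r4 rM₀ ⊢
          linarith
      · interval_cases d
        · have rz1 : (z : ℝ) ≤ 1 := by exact_mod_cast hzodd odd_one
          have h3 := mul_le_mul_of_nonneg_right rz1 (by linarith : (0 : ℝ) ≤ a * b)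
          norm_num at r4 rM ⊢
          have h4 : (a * b : ℝ) / 2 ≤ M - a * b / 2 := by linarith
          have h5 := mul_le_mul_of_nonneg_left h4 (by linarith : (0 : ℝ) ≤ a * b / 2)
          have h6 := mul_le_mul_of_nonneg_left r4 (by linarith : (0 : ℝ) ≤ a * b)
          linarith
        · norm_num at r4 rM₀ ⊢
          have h4 : (2 : ℝ) ≤ M - 2 * a * (2 * b) / 2 := by linarith
          have h5 := mul_le_mul_of_nonneg_left h4 (by linarith : (0 : ℝ) ≤ 2 * a * (2 * b) / 2)
          linarith
    · push Not at hd3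
      have rd3 : (3 : ℝ) ≤ d := by exact_mod_cast hd3
      have e₁ := endpoint_max rd3 ra rb
      have e₂ : (d * a * (d * b) : ℝ) ≤ 2 * max ((d : ℝ) * a) (d * b) *
          (M - 2 * max ((d : ℝ) * a) (d * b)) :=
        e₁.trans (mul_le_mul_of_nonneg_left (by linarith) (by linarith))
      refine rsmall (le_mul_sub_of_endpoints rk2 rlt ?_ e₂)
      rcases hs with hs | ⟨rfl, rfl, hs⟩
      · obtain rfl : d = 3 := by omega
        -- With z = 2 the estimate at k = 2 would fail for large a and b.
        have hz1 : z ≤ 1 := hzodd ⟨1, rfl⟩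
        have rz1 : (z : ℝ) ≤ 1 := by exact_mod_cast hz1
        have h3 := mul_le_mul_of_nonneg_right rz1 (by linarith : (0 : ℝ) ≤ a * b)
        push_cast at rM ⊢
        linarith
      -- At k = 2 it suffices that 8d − 12 ≥ d², that is (d − 2)(6 − d) ≥ 0: hence the limit 6.
      · have rd6 : (d : ℝ) ≤ 6 := by exact_mod_cast hs
        push_cast at rM₀ ⊢
        nlinarith [mul_nonneg (sub_nonneg.2 rd3) (sub_nonneg.2 rd6)]
  · simp only [smallSide, hs, if_false] at hk
    push Not at hs
    have rd3 : (3 : ℝ) ≤ d := by exact_mod_cast hs.1.le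
    have e₁ := endpoint_max rd3 ra rb
    have e₂ : (d * a * (d * b) : ℝ) ≤ 2 * max ((d : ℝ) * a) (d * b) *
        (M - 2 * max ((d : ℝ) * a) (d * b)) :=
      e₁.trans (mul_le_mul_of_nonneg_left (by linarith) (by linarith))
    have e₀ : (d * a * (d * b) : ℝ) ≤ (d + 2) / 2 * (M - (d + 2) / 2) :=
      (endpoint_low (by linarith) ra rb).trans
        (mul_le_mul_of_nonneg_left (by linarith) (by linarith))
    have rk0 : ((d : ℝ) + 2) / 2 ≤ k := by
      have : ((d + 2 : ℕ) : ℝ) ≤ (2 * k : ℕ) := by exact_mod_cast (show d + 2 ≤ 2 * k by omega)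
      push_cast at this
      linarith
    exact rsmall (le_mul_sub_of_endpoints rk0 rlt e₀ e₂)

end Arithmetic

/-! ### Common neighbors of adjacent vertices, and the dichotomy -/

section CommonNeighbors

open Finset

variable {X Y R : Type*} [Fintype X] [Fintype Y] [Fintype R] [DecidableEq X] [DecidableEq Y]
  [DecidableEq R] [AddCommGroup R]

namespace IsQueenGraph

variable {G : SimpleGraph (X × Y)} {A : X → R} {B : Y → R} {a b : ℕ}

theorem le_common_of_row (h : IsQueenGraph G A B a b) {p q : X × Y} (h2 : p.2 = q.2)
    (hA : A p.1 ≠ A q.1) : Fintype.card X + 2 * b ≤ #(nbrs G p ∩ nbrs G q) + 2 := by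
  have hne : p ≠ q := fun e => hA (by rw [e])
  have hne1 : p.1 ≠ q.1 := fun e => hA (by rw [e])
  -- The row, then the points where the diagonal of each vertex meets the column of the other.
  set T₀ : Finset (X × Y) := Finset.univ ×ˢ {p.2} with hT₀
  set T₁ : Finset (X × Y) := {q.1} ×ˢ ({y | B y = A q.1 - A p.1 + B p.2} : Finset Y) with hT₁
  set T₂ : Finset (X × Y) := {p.1} ×ˢ ({y | B y = A p.1 - A q.1 + B p.2} : Finset Y) with hT₂
  have c₀ : #((T₀.erase p).erase q) + 2 = Fintype.card X := by
    rw [Finset.card_erase_of_mem, Finset.card_erase_of_mem]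
    · have : Fintype.card X = #T₀ := by simp [hT₀]
      have h2 : 2 ≤ #T₀ := Finset.one_lt_card.2 ⟨p, by simp [hT₀], q, by simp [hT₀, h2], hne⟩
      omega
    · simp [hT₀]
    · simp [hT₀, h2, hne.symm]
  have c₁ : #T₁ = b := by simp [hT₁, h.card_snd]
  have c₂ : #T₂ = b := by simp [hT₂, h.card_snd]
  have c₁₂ : #(T₁ ∪ T₂) = b + b := by
    rw [Finset.card_union_of_disjoint, c₁, c₂]
    refine Finset.disjoint_left.2 fun r hr hr' => hne1 ?_
    simp only [hT₁, hT₂, mem_product, mem_singleton] at hr hr'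
    rw [← hr'.1, hr.1]
  have hy : ∀ r ∈ T₁ ∪ T₂, r.2 ≠ p.2 := by
    intro r hr e
    simp only [hT₁, hT₂, mem_union, mem_product, mem_singleton, mem_filter, mem_univ, true_and,
      e, right_eq_add, sub_eq_zero] at hr
    rcases hr with hr | hr
    · exact hA hr.2.symm
    · exact hA hr.2
  have c : #((T₀.erase p).erase q ∪ (T₁ ∪ T₂)) = #((T₀.erase p).erase q) + (b + b) := by
    rw [Finset.card_union_of_disjoint, c₁₂]
    refine Finset.disjoint_left.2 fun r hr hr' => hy r hr' ?_
    simp only [hT₀, mem_erase, mem_product, mem_singleton] at hr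
    exact hr.2.2.2
  have hsub : (T₀.erase p).erase q ∪ (T₁ ∪ T₂) ⊆ nbrs G p ∩ nbrs G q := by
    intro r hr
    rw [Finset.mem_inter, mem_nbrs, mem_nbrs, h.adj_iff, h.adj_iff]
    rcases Finset.mem_union.1 hr with hr | hr
    · simp only [hT₀, mem_erase, mem_product, mem_singleton] at hr
      exact ⟨⟨hr.2.1.symm, Or.inr (Or.inl hr.2.2.2.symm)⟩,
        ⟨hr.1.symm, Or.inr (Or.inl (h2 ▸ hr.2.2.2.symm))⟩⟩
    · have hy' := hy r hr
      refine ⟨⟨fun e => hy' (by rw [e]), ?_⟩, ⟨fun e => hy' (by rw [h2, e]), ?_⟩⟩ <;>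
      · simp only [hT₁, hT₂, mem_union, mem_product, mem_singleton, mem_filter, mem_univ,
          true_and] at hr
        rcases hr with ⟨h3, h4⟩ | ⟨h3, h4⟩
        · simp only [h3, h4, h2]
          first
          | exact Or.inl trivial
          | exact Or.inr (Or.inr (Or.inl (by abel)))
        · simp only [h3, h4, h2]
          first
          | exact Or.inl trivial
          | exact Or.inr (Or.inr (Or.inl (by abel)))
  have := Finset.card_le_card hsub
  omega

theorem swap (h : IsQueenGraph G A B a b) :
    IsQueenGraph (G.comap (Equiv.prodComm Y X)) B A b a where
  adj_iff p q := by
    rw [SimpleGraph.comap_adj, h.adj_iff, (Equiv.prodComm Y X).injective.ne_iff]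
    simp only [Equiv.prodComm_apply, Prod.fst_swap, Prod.snd_swap]
    rw [add_comm (A p.2), add_comm (A q.2), ← neg_inj (a := A p.2 - B p.1), neg_sub, neg_sub]
    tauto
  card_fst := h.card_snd
  card_snd := h.card_fst

theorem card_common_swap (p q : X × Y) :
    #(nbrs (G.comap (Equiv.prodComm Y X)) p.swap ∩ nbrs (G.comap (Equiv.prodComm Y X)) q.swap) =
      #(nbrs G p ∩ nbrs G q) := by
  rw [← Finset.card_map (Equiv.prodComm Y X).toEmbedding]
  congr 1
  ext r
  simp [Finset.mem_map_equiv]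

theorem le_common_of_col (h : IsQueenGraph G A B a b) {p q : X × Y} (h1 : p.1 = q.1)
    (hB : B p.2 ≠ B q.2) : Fintype.card Y + 2 * a ≤ #(nbrs G p ∩ nbrs G q) + 2 := by
  have := h.swap.le_common_of_row (p := p.swap) (q := q.swap) h1 hB
  rwa [card_common_swap] at this

/-- Two vertices on a common diagonal; antidiagonals are covered by `B' = B` and diagonals by
`B' = -B`. -/
theorem le_common_of_line (h : IsQueenGraph G A B a b) {B' : Y → R}
    (hB' : ∀ r, #{y | B' y = r} = b)
    (hadj : ∀ p q : X × Y, p ≠ q → A p.1 + B' p.2 = A q.1 + B' q.2 → G.Adj p q)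
    {p q : X × Y} (hne : p ≠ q) (hpq : A p.1 + B' p.2 = A q.1 + B' q.2) :
    Fintype.card R * a * b ≤ #(nbrs G p ∩ nbrs G q) + 2 ∧
      (A p.1 ≠ A q.1 → Fintype.card R * a * b ≤ #(nbrs G p ∩ nbrs G q)) := by
  set D : Finset (X × Y) := {r | A r.1 + B' r.2 = A p.1 + B' p.2} with hD
  have cD : #D = Fintype.card R * a * b := card_sum_eq h.card_fst hB' _
  have hp : p ∈ D := by simp [hD]
  have hq : q ∈ D := by simp [hD, hpq]
  have hDsub : (D.erase p).erase q ⊆ nbrs G p ∩ nbrs G q := by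
    intro r hr
    simp only [hD, mem_erase, mem_filter, mem_univ, true_and] at hr
    rw [Finset.mem_inter, mem_nbrs, mem_nbrs]
    exact ⟨hadj _ _ hr.2.1.symm hr.2.2.symm, hadj _ _ hr.1.symm (by rw [← hpq, hr.2.2])⟩
  have c₀ : #((D.erase p).erase q) + 2 = #D := by
    rw [Finset.card_erase_of_mem (Finset.mem_erase.2 ⟨hne.symm, hq⟩), Finset.card_erase_of_mem hp]
    have h2 : 2 ≤ #D := Finset.one_lt_card.2 ⟨p, hp, q, hq, hne⟩
    omega
  refine ⟨by have := Finset.card_le_card hDsub; omega, fun hA => ?_⟩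
  have hA1 : p.1 ≠ q.1 := fun e => hA (by rw [e])
  have hB2 : B' p.2 ≠ B' q.2 := fun e => hA (by rwa [e, add_left_inj] at hpq)
  have hB1 : p.2 ≠ q.2 := fun e => hB2 (by rw [e])
  -- The two corners of the rectangle spanned by `p` and `q`; they lie off the common line because
  -- the values of `A` differ.
  set T : Finset (X × Y) := {(p.1, q.2), (q.1, p.2)} with hT
  have cT : #T = 2 := Finset.card_pair fun e => hA1 (Prod.ext_iff.1 e).1
  have hdis : Disjoint ((D.erase p).erase q) T := by
    refine Finset.disjoint_left.2 fun r hr hr' => ?_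
    simp only [hD, mem_erase, mem_filter, mem_univ, true_and] at hr
    rcases Finset.mem_insert.1 hr' with rfl | hr'
    · exact hB2 (add_left_cancel hr.2.2).symm
    · rw [Finset.mem_singleton.1 hr'] at hr
      exact hA (add_right_cancel hr.2.2).symm
  have hTsub : T ⊆ nbrs G p ∩ nbrs G q := by
    intro r hr
    rw [Finset.mem_inter, mem_nbrs, mem_nbrs, h.adj_iff, h.adj_iff]
    rcases Finset.mem_insert.1 hr with rfl | hr
    · exact ⟨⟨fun e => hB1 (Prod.ext_iff.1 e).2, Or.inl rfl⟩,
        ⟨fun e => hA1 (Prod.ext_iff.1 e).1.symm, Or.inr (Or.inl rfl)⟩⟩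
    · rw [Finset.mem_singleton.1 hr]
      exact ⟨⟨fun e => hA1 (Prod.ext_iff.1 e).1, Or.inr (Or.inl rfl)⟩,
        ⟨fun e => hB1 (Prod.ext_iff.1 e).2.symm, Or.inl rfl⟩⟩
  have := Finset.card_le_card (Finset.union_subset hDsub hTsub)
  rw [Finset.card_union_of_disjoint hdis] at this
  omega

theorem injective_of_card_fiber_eq_one {A : X → R} (hA : ∀ r, #{x | A x = r} = 1) :
    Function.Injective A := fun x y hxy =>
  Finset.card_le_one.1 (hA (A y)).le x (by simp [hxy]) y (by simp)

/-- The number required is s + 3 for s = (d + 1)/2. If two vertices of a row have the same `A`-value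
they also share a diagonal, so the line estimate takes over; likewise for columns. -/
theorem le_common (h : IsQueenGraph G A B a b) (ha : 1 ≤ a) (hb : 1 ≤ b)
    (hd : 4 ≤ Fintype.card R) (hab : a = 1 → b = 1 → 7 ≤ Fintype.card R) {p q : X × Y}
    (hpq : G.Adj p q) : (Fintype.card R + 1) / 2 + 3 ≤ #(nbrs G p ∩ nbrs G q) := by
  obtain ⟨hne, hline⟩ := (h.adj_iff p q).1 hpq
  have line : ∀ B' : Y → R, (∀ r, #{y | B' y = r} = b) →
      (∀ p q : X × Y, p ≠ q → A p.1 + B' p.2 = A q.1 + B' q.2 → G.Adj p q) →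
      A p.1 + B' p.2 = A q.1 + B' q.2 →
      (Fintype.card R + 1) / 2 + 3 ≤ #(nbrs G p ∩ nbrs G q) := by
    intro B' hB' hadj he
    obtain ⟨h1, h2⟩ := h.le_common_of_line hB' hadj hne he
    by_cases h11 : a = 1 ∧ b = 1
    · obtain ⟨rfl, rfl⟩ := h11
      have hA : A p.1 ≠ A q.1 := fun e => hne <| by
        rw [e, add_right_inj] at he
        exact Prod.ext (injective_of_card_fiber_eq_one h.card_fst e)
          (injective_of_card_fiber_eq_one hB' he)
      have h3 := h2 hA
      have h4 := hab rfl rfl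
      omega
    · have h3 : 2 ≤ a * b := by
        by_contra! hlt
        have := Nat.le_mul_of_pos_right a hb
        have := Nat.le_mul_of_pos_left b ha
        omega
      have h4 := Nat.mul_le_mul_left (Fintype.card R) h3
      rw [mul_assoc] at h1
      omega
  have hBadj : ∀ p q : X × Y, p ≠ q → A p.1 + B p.2 = A q.1 + B q.2 → G.Adj p q :=
    fun p q hne he => (h.adj_iff p q).2 ⟨hne, Or.inr (Or.inr (Or.inr he))⟩
  have hnum : ∀ c e : ℕ, 1 ≤ c → 1 ≤ e → (c = 1 → e = 1 → 7 ≤ Fintype.card R) →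
      (Fintype.card R + 1) / 2 + 5 ≤ Fintype.card R * c + 2 * e := by
    intro c e hc he h7
    rcases hc.eq_or_lt with rfl | hc
    · rcases he.eq_or_lt with rfl | he
      · have := h7 rfl rfl
        omega
      · omega
    · have := Nat.mul_le_mul_left (Fintype.card R) hc
      omega
  rcases hline with h1 | h2 | h3 | h4
  · by_cases hB : B p.2 = B q.2
    · exact line B h.card_snd hBadj (by rw [h1, hB])
    · have h5 := h.le_common_of_col h1 hB
      have h6 := hnum b a hb ha fun e1 e2 => hab e2 e1
      rw [h.card_snd_type] at h5
      omega
  · by_cases hA : A p.1 = A q.1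
    · exact line B h.card_snd hBadj (by rw [h2, hA])
    · have h5 := h.le_common_of_row h2 hA
      have h6 := hnum a b ha hb hab
      rw [h.card_fst_type] at h5
      omega
  · refine line (-B) (card_neg_fiber h.card_snd) (fun p q hne he => ?_) ?_
    · exact (h.adj_iff p q).2 ⟨hne, Or.inr (Or.inr (Or.inl (by simpa [sub_eq_add_neg] using he)))⟩
    · simpa [sub_eq_add_neg] using h3
  · exact line B h.card_snd hBadj h4

theorem firingDichotomy [Nonempty (X × Y)] (h : IsQueenGraph G A B a b)
    (hcard : 4 ≤ Fintype.card (X × Y)) (hz : #{t : R | t + t = 0} ≤ 2)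
    (hzodd : Odd (Fintype.card R) → #{t : R | t + t = 0} ≤ 1) :
    FiringDichotomy G (smallSide (Fintype.card R) a b) := by
  have hX := h.card_fst_type
  have hY := h.card_snd_type
  have hnb := h.le_card_nbrs (z := #{t : R | t + t = 0}) le_rfl
  have hcom := h.le_common
  generalize #{t : R | t + t = 0} = z at hz hzodd hnb
  generalize Fintype.card R = d at hX hY hnb hcom hzodd ⊢
  have hN : Fintype.card (X × Y) = d * a * (d * b) := by
    rw [Fintype.card_prod, hX, hY]
  have hpos : 0 < d * a * (d * b) := by omega
  have hd1 : 1 ≤ d := Nat.pos_of_ne_zero fun e => by simp [e] at hpos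
  have ha1 : 1 ≤ a := Nat.pos_of_ne_zero fun e => by simp [e] at hpos
  have hb1 : 1 ≤ b := Nat.pos_of_ne_zero fun e => by simp [e] at hpos
  have hsub : z * (a * b) + a + b ≤ 2 * (d * a * b) + d * a + d * b := by
    have h1 : z ≤ 2 * d := by omega
    have h2 := Nat.mul_le_mul_right (a * b) h1
    have h3 := Nat.mul_le_mul_right a hd1
    have h4 := Nat.mul_le_mul_right b hd1
    have h5 : 2 * d * (a * b) = 2 * (d * a * b) := by ring
    omega
  obtain ⟨M, hM⟩ := Nat.exists_eq_add_of_le hsub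
  have hM' : 2 * (d * a * b) + d * a + d * b = M + z * (a * b) + a + b := by omega
  have hMdeg : ∀ p, M ≤ #(nbrs G p) + 1 := fun p => by
    have := hnb p
    omega
  have hα := FiringDichotomy.indepNum_pos (G := G)
  refine ⟨fun U hU hUc hcut => ?_, fun p => ?_, ?_, h.card_independent_neighbors_le,
    h.diameterLeTwo⟩
  · have key : ∀ U : Finset (X × Y), #U ≤ #Uᶜ → cut G U < d * a * (d * b) →
        #U ≤ smallSide d a b := by
      intro U hle hc
      refine le_smallSide hd1 ha1 hb1 (hN ▸ hcard) hz hzodd ?_ hle hc hM'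
        (card_mul_le_cut_add G hMdeg U) ?_
      · rw [Finset.card_add_card_compl, hN]
      · refine h.card_mul_card_compl_le ?_ ?_ U
        · rw [hX]; exact le_max_left _ _
        · rw [hY]; exact le_max_right _ _
    rcases le_total (#U) (#Uᶜ) with hle | hle
    · exact Or.inl (key U hle (by omega))
    · exact Or.inr (key Uᶜ (by rwa [compl_compl]) (by rw [cut_compl]; omega))
  · have h1 := hMdeg p
    have hab1 : 1 ≤ a * b := Nat.mul_pos ha1 hb1
    suffices smallSide d a b + 2 ≤ M by omega
    have hda : d * a * b = d * (a * b) := mul_assoc _ _ _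
    rw [hN] at hcard
    have hcard' : d * a * (d * b) = d * d * (a * b) := by ring
    have hda1 := Nat.mul_le_mul_left d ha1
    have hdb1 := Nat.mul_le_mul_left d hb1
    rcases (show d = 1 ∨ d = 2 ∨ 3 ≤ d by omega) with h1 | h1 | h3
    · have hz1 := hzodd (h1 ▸ odd_one)
      have hz2 := Nat.mul_le_mul_right (a * b) hz1
      rw [h1] at hM' hda hcard hcard' ⊢
      simp only [smallSide]
      norm_num
      omega
    · have hz2 := Nat.mul_le_mul_right (a * b) hz
      rw [h1] at hM' hda hcard hcard' ⊢
      simp only [smallSide]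
      norm_num
      omega
    · have hz2 := Nat.mul_le_mul_right (a * b) hz
      have h4 : smallSide d a b ≤ (d + 1) / 2 := by
        unfold smallSide
        split_ifs <;> omega
      obtain ⟨e, rfl⟩ := Nat.exists_eq_add_of_le h3
      have h5 : (3 + e) * (a * b) = 3 * (a * b) + e * (a * b) := by ring
      have h6 : (3 + e) * a = 3 * a + e * a := by ring
      have h7 : (3 + e) * b = 3 * b + e * b := by ring
      have h8 := Nat.mul_le_mul_left e hab1
      have h9 := Nat.mul_le_mul_left e ha1
      have h10 := Nat.mul_le_mul_left e hb1
      omega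
  · by_cases hs : d ≤ 3 ∨ (a = 1 ∧ b = 1 ∧ d ≤ 6)
    · left
      simp [smallSide, hs]
    · right
      intro p q hpq
      simp only [smallSide, hs, if_false]
      push Not at hs
      exact hcom ha1 hb1 hs.1 (fun e1 e2 => hs.2 e1 e2) hpq

end IsQueenGraph

end CommonNeighbors

/-! ### The toroidal board as an abstract queen's graph over ℤ/d -/

section Torus

open Finset

theorem card_castHom_fiber {m d : ℕ} [NeZero m] [NeZero d] (h : d ∣ m) (r : ZMod d) :
    #{x : ZMod m | ZMod.castHom h (ZMod d) x = r} = m / d := by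
  have hsurj := ZMod.castHom_surjective h
  have hfib : ∀ r, #{x : ZMod m | ZMod.castHom h (ZMod d) x = r} =
      #{x : ZMod m | ZMod.castHom h (ZMod d) x = 0} := fun r =>
    AddMonoidHom.card_fiber_eq_of_mem_range (ZMod.castHom h (ZMod d)) (hsurj r) (hsurj 0)
  have hsum := Finset.card_eq_sum_card_fiberwise (s := (Finset.univ : Finset (ZMod m)))
    (f := ZMod.castHom h (ZMod d)) (t := Finset.univ) (fun x _ => Finset.mem_univ _)
  rw [Finset.sum_congr rfl fun r _ => hfib r] at hsum
  simp only [Finset.card_univ, ZMod.card, Finset.sum_const, smul_eq_mul] at hsum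
  rw [hfib]
  exact (Nat.div_eq_of_eq_mul_right (NeZero.pos d) hsum).symm

/-- Chinese remainder theorem for non-coprime moduli: a common k exists iff the two displacements
agree modulo the gcd. The witness comes from Bézout. -/
theorem exists_int_add_iff {m n d : ℕ} (hd : d = Nat.gcd m n) (hm : d ∣ m) (hn : d ∣ n)
    (x x' : ZMod m) (y y' : ZMod n) : (∃ k : ℤ, x' = x + k ∧ y' = y + k) ↔
      ZMod.castHom hm (ZMod d) (x' - x) = ZMod.castHom hn (ZMod d) (y' - y) := by
  constructor
  · rintro ⟨k, rfl, rfl⟩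
    simp
  · intro h
    obtain ⟨u, hu⟩ := ZMod.intCast_surjective (x' - x)
    obtain ⟨v, hv⟩ := ZMod.intCast_surjective (y' - y)
    rw [← hu, ← hv, map_intCast, map_intCast, ZMod.intCast_eq_intCast_iff_dvd_sub] at h
    obtain ⟨q, hq⟩ := h
    have hb := Nat.gcd_eq_gcd_ab m n
    rw [← hd] at hb
    refine ⟨u + m * (Nat.gcdA m n * q), ?_, ?_⟩
    · push_cast
      rw [hu]
      simp
    · have : u + m * (Nat.gcdA m n * q) = v - n * (Nat.gcdB m n * q) := by
        rw [hb] at hq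
        linear_combination -hq
      rw [this]
      push_cast
      rw [hv]
      simp

theorem exists_int_sub_iff {m n d : ℕ} (hd : d = Nat.gcd m n) (hm : d ∣ m) (hn : d ∣ n)
    (x x' : ZMod m) (y y' : ZMod n) : (∃ k : ℤ, x' = x + k ∧ y' = y - k) ↔
      ZMod.castHom hm (ZMod d) (x' - x) = ZMod.castHom hn (ZMod d) (y - y') := by
  rw [← neg_sub y' y, ← neg_sub_neg y y', neg_sub, ← exists_int_add_iff hd hm hn x x' (-y) (-y')]
  refine exists_congr fun k => and_congr_right fun _ => ?_
  rw [← neg_inj (a := y'), neg_sub', sub_neg_eq_add]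

theorem isQueenGraph_torus {m n d : ℕ} [NeZero m] [NeZero n] [NeZero d] (hd : d = Nat.gcd m n)
    (hm : d ∣ m) (hn : d ∣ n) :
    IsQueenGraph (toroidalQueenGraph m n) (ZMod.castHom hm (ZMod d)) (ZMod.castHom hn (ZMod d))
      (m / d) (n / d) where
  adj_iff p q := by
    change (p ≠ q ∧ _) ↔ _
    rw [exists_int_add_iff hd hm hn, exists_int_sub_iff hd hm hn]
    refine and_congr_right fun _ => or_congr_right (or_congr_right ?_)
    simp only [map_sub]
    refine or_congr ⟨fun h => ?_, fun h => ?_⟩ ⟨fun h => ?_, fun h => ?_⟩ <;>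
      linear_combination -h
  card_fst := card_castHom_fiber hm
  card_snd := card_castHom_fiber hn

theorem card_two_torsion_le (d : ℕ) [NeZero d] : #{t : ZMod d | t + t = 0} ≤ 2 := by
  have := IsAddCyclic.card_nsmul_eq_zero_le (α := ZMod d) (n := 2) two_pos
  simp only [two_nsmul] at this
  convert this

theorem card_two_torsion_le_of_odd {d : ℕ} [NeZero d] (hd : Odd d) :
    #{t : ZMod d | t + t = 0} ≤ 1 := by
  obtain ⟨k, hk⟩ := hd
  refine Finset.card_le_one.2 fun s hs t ht => ?_
  have h0 : ∀ t : ZMod d, t + t = 0 → t = 0 := fun t ht => by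
    have h1 : (2 * k + 1 : ZMod d) = 0 := by
      have : ((2 * k + 1 : ℕ) : ZMod d) = 0 := by rw [← hk]; simp
      exact_mod_cast this
    linear_combination t * h1 - k * ht
  rw [h0 s (by simpa using hs), h0 t (by simpa using ht)]

theorem firingDichotomy_torus {m n : ℕ} [NeZero m] [NeZero n] (hm : 2 ≤ m) (hn : 2 ≤ n) :
    ∃ s, FiringDichotomy (toroidalQueenGraph m n) s := by
  have : NeZero (Nat.gcd m n) := ⟨(Nat.gcd_pos_of_pos_left n (by omega)).ne'⟩
  refine ⟨_, (isQueenGraph_torus rfl (Nat.gcd_dvd_left m n) (Nat.gcd_dvd_right m n)).firingDichotomy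
    ?_ (card_two_torsion_le _) fun h => ?_⟩
  · rw [Fintype.card_prod, ZMod.card, ZMod.card]
    nlinarith
  · rw [ZMod.card] at h
    exact card_two_torsion_le_of_odd h

end Torus

/-! ### Placements of d queens with at most two per column -/

section IndependenceNumber

open Finset

/-- The fibers of `f` embed separately into those of `A`. This spreads queens sharing a residue over
different columns or rows of the large board. -/
theorem exists_injective_lift {ι X R : Type*} [Fintype ι] [Fintype X] [DecidableEq R] (f : ι → R)
    (A : X → R) (h : ∀ r, #{i | f i = r} ≤ #{x | A x = r}) :
    ∃ φ : ι → X, Function.Injective φ ∧ ∀ i, A (φ i) = f i := by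
  have hemb : ∀ r, Nonempty ({i // f i = r} ↪ {x // A x = r}) := fun r => by
    refine Function.Embedding.nonempty_of_card_le ?_
    rw [Fintype.card_subtype, Fintype.card_subtype]
    exact h r
  let E : ∀ r, {i // f i = r} ↪ {x // A x = r} := fun r => (hemb r).some
  refine ⟨fun i => (E (f i) ⟨i, rfl⟩).1, fun i j hij => ?_, fun i => (E (f i) ⟨i, rfl⟩).2⟩
  have hf : f i = f j := by
    rw [← (E (f i) ⟨i, rfl⟩).2, ← (E (f j) ⟨j, rfl⟩).2]
    exact congrArg A hij
  have key : ∀ r (hi : f i = r) (hj : f j = r),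
      (E r ⟨i, hi⟩).1 = (E r ⟨j, hj⟩).1 → i = j := fun r hi hj he =>
    congrArg Subtype.val ((E r).injective (Subtype.ext he))
  refine key (f j) hf rfl ?_
  have h1 : ∀ r (hi : f i = r), (E (f i) ⟨i, rfl⟩).1 = (E r ⟨i, hi⟩).1 := by
    rintro r rfl; rfl
  rw [← h1 (f j) hf]
  exact hij

theorem card_fiber_le_two {ι R : Type*} [Fintype ι] [DecidableEq R] (f : ι → R) (P : ι → Prop)
    [DecidablePred P] (h₁ : ∀ i j, P i → P j → f i = f j → i = j)
    (h₂ : ∀ i j, ¬ P i → ¬ P j → f i = f j → i = j) (r : R) : #{i | f i = r} ≤ 2 := by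
  have c : #{i ∈ ({i | f i = r} : Finset ι) | P i} + #{i ∈ ({i | f i = r} : Finset ι) | ¬ P i} =
      #{i | f i = r} := Finset.card_filter_add_card_filter_not P
  have c₁ : #{i ∈ ({i | f i = r} : Finset ι) | P i} ≤ 1 := Finset.card_le_one.2 fun i hi j hj => by
    simp only [mem_filter, mem_univ, true_and] at hi hj
    exact h₁ i j hi.2 hj.2 (hi.1.trans hj.1.symm)
  have c₂ : #{i ∈ ({i | f i = r} : Finset ι) | ¬ P i} ≤ 1 :=
    Finset.card_le_one.2 fun i hi j hj => by
      simp only [mem_filter, mem_univ, true_and] at hi hj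
      exact h₂ i j hi.2 hj.2 (hi.1.trans hj.1.symm)
  omega

theorem card_fiber_le_of_injective {ι R : Type*} [Fintype ι] [DecidableEq R] {f : ι → R}
    (hf : Function.Injective f) (r : R) : #{i | f i = r} ≤ 1 :=
  Finset.card_le_one.2 fun i hi j hj => by
    simp only [mem_filter, mem_univ, true_and] at hi hj
    exact hf (hi.trans hj.symm)

/-- Turns a congruence between values of a piecewise linear map into finitely many equations, one
for each possible quotient t. -/
theorem quotient_bounds {n w lo hi t : ℤ} (hn : 0 < n) (hlo : n * lo < w) (hhi : w < n * hi)
    (h : w = n * t) : lo < t ∧ t < hi :=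
  ⟨lt_of_mul_lt_mul_left (h ▸ hlo) hn.le, lt_of_mul_lt_mul_left (h ▸ hhi) hn.le⟩

/-- The residues modulo `d` of a sequence of integers. -/
def residues (d : ℕ) (f : ℤ → ℤ) (i : Fin d) : ZMod d := (f (i : ℕ) : ZMod d)

theorem residues_eq_iff {d : ℕ} {f : ℤ → ℤ} {i j : Fin d} :
    residues d f i = residues d f j ↔ ∃ t : ℤ, f (j : ℕ) - f (i : ℕ) = d * t := by
  unfold residues
  rw [ZMod.intCast_eq_intCast_iff_dvd_sub]
  rfl

theorem residues_injective {d : ℕ} {f : ℤ → ℤ}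
    (h : ∀ i j t : ℤ, 0 ≤ i → i < j → j < d → f j - f i ≠ d * t) :
    Function.Injective (residues d f) := by
  intro i j hij
  have hi := i.isLt
  have hj := j.isLt
  rcases lt_trichotomy (i : ℕ) (j : ℕ) with hlt | heq | hlt
  · obtain ⟨t, ht⟩ := residues_eq_iff.1 hij
    exact absurd ht (h _ _ t (by omega) (by omega) (by omega))
  · exact Fin.ext heq
  · obtain ⟨t, ht⟩ := residues_eq_iff.1 hij.symm
    exact absurd ht (h _ _ t (by omega) (by omega) (by omega))

theorem card_fiber_residues_le_two {d : ℕ} {f : ℤ → ℤ} (P : ℤ → Prop)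
    (h₁ : ∀ i j t : ℤ, 0 ≤ i → i < j → j < d → P i → P j → f j - f i ≠ d * t)
    (h₂ : ∀ i j t : ℤ, 0 ≤ i → i < j → j < d → ¬ P i → ¬ P j → f j - f i ≠ d * t)
    (r : ZMod d) : #{i | residues d f i = r} ≤ 2 := by
  classical
  refine card_fiber_le_two _ (fun i : Fin d => P (i : ℕ)) ?_ ?_ r <;> intro i j hi hj hij
  all_goals
    have hi' := i.isLt
    have hj' := j.isLt
    rcases lt_trichotomy (i : ℕ) (j : ℕ) with hlt | heq | hlt
  · obtain ⟨t, ht⟩ := residues_eq_iff.1 hij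
    exact absurd ht (h₁ _ _ t (by omega) (by omega) (by omega) hi hj)
  · exact Fin.ext heq
  · obtain ⟨t, ht⟩ := residues_eq_iff.1 hij.symm
    exact absurd ht (h₁ _ _ t (by omega) (by omega) (by omega) hj hi)
  · obtain ⟨t, ht⟩ := residues_eq_iff.1 hij
    exact absurd ht (h₂ _ _ t (by omega) (by omega) (by omega) hi hj)
  · exact Fin.ext heq
  · obtain ⟨t, ht⟩ := residues_eq_iff.1 hij.symm
    exact absurd ht (h₂ _ _ t (by omega) (by omega) (by omega) hj hi)

/-- A board of side `d` carries `d` queens, no two in the same row, diagonal or antidiagonal, and at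
most two in each column. -/
def HasTwoPerColumn (d : ℕ) : Prop :=
  ∃ x y : Fin d → ZMod d, Function.Injective x ∧ (∀ r, #{i | y i = r} ≤ 2) ∧
    (Function.Injective fun i => x i + y i) ∧ (Function.Injective fun i => x i - y i)

theorem hasTwoPerColumn_of_int {d : ℕ} (x y : ℤ → ℤ) (P : ℤ → Prop)
    (hx : ∀ i j t : ℤ, 0 ≤ i → i < j → j < d → x j - x i ≠ d * t)
    (h₁ : ∀ i j t : ℤ, 0 ≤ i → i < j → j < d → P i → P j → y j - y i ≠ d * t)
    (h₂ : ∀ i j t : ℤ, 0 ≤ i → i < j → j < d → ¬ P i → ¬ P j → y j - y i ≠ d * t)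
    (hu : ∀ i j t : ℤ, 0 ≤ i → i < j → j < d → (x j + y j) - (x i + y i) ≠ d * t)
    (hv : ∀ i j t : ℤ, 0 ≤ i → i < j → j < d → (x j - y j) - (x i - y i) ≠ d * t) :
    HasTwoPerColumn d := by
  refine ⟨residues d x, residues d y, residues_injective hx, card_fiber_residues_le_two P h₁ h₂,
    ?_, ?_⟩
  · convert residues_injective (f := fun i => x i + y i) hu using 2
    simp [residues]
  · convert residues_injective (f := fun i => x i - y i) hv using 2
    simp [residues]

theorem ne_mul_of_coprime {d : ℕ} {c i j t : ℤ} (hc : IsCoprime c d) (h0 : 0 ≤ i) (hij : i < j)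
    (hj : j < d) : c * j - c * i ≠ d * t := by
  intro h
  have h1 : (d : ℤ) ∣ c * (j - i) := ⟨t, by linear_combination h⟩
  have h2 := Int.le_of_dvd (by omega) (hc.symm.dvd_of_dvd_mul_left h1)
  omega

theorem isCoprime_three {d : ℕ} (h : ¬ 3 ∣ d) : IsCoprime (3 : ℤ) d := by
  have := (Nat.Prime.coprime_iff_not_dvd Nat.prime_three).2 h
  exact_mod_cast Nat.isCoprime_iff_coprime.2 this

/-- With y = 2x the sums are 3x and the differences −x, while doubling is injective on each half of
the indices. -/
theorem hasTwoPerColumn_of_not_three_dvd {d : ℕ} (h : ¬ 3 ∣ d) : HasTwoPerColumn d := by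
  refine hasTwoPerColumn_of_int (fun i => i) (fun i => 2 * i) (fun i => 2 * i < d) ?_ ?_ ?_ ?_ ?_
  · intro i j t h0 hij hj
    simpa using ne_mul_of_coprime (c := 1) (t := t) isCoprime_one_left h0 hij hj
  · intro i j t h0 hij hj hi' hj' ht
    obtain ⟨h1, h2⟩ := quotient_bounds (lo := 0) (hi := 1) (by omega) (by omega) (by omega) ht
    omega
  · intro i j t h0 hij hj hi' hj' ht
    obtain ⟨h1, h2⟩ := quotient_bounds (lo := 0) (hi := 1) (by omega) (by omega) (by omega) ht
    omega
  · intro i j t h0 hij hj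
    convert ne_mul_of_coprime (t := t) (isCoprime_three h) h0 hij hj using 1
    ring
  · intro i j t h0 hij hj
    convert ne_mul_of_coprime (c := -1) (t := t) ⟨-1, 0, by ring⟩ h0 hij hj using 1
    ring

theorem hasTwoPerColumn_six : HasTwoPerColumn 6 := by
  refine ⟨![0, 1, 2, 3, 4, 5], ![0, 2, 5, 2, 0, 3], ?_, ?_, ?_, ?_⟩ <;> decide

/-- The sums are 3j + c j, and 3j alone is three-to-one. The three shifts have different residues
modulo 3, and each is used on a complete residue system modulo d/3. The same mechanism serves the
two even families below. -/
theorem hasTwoPerColumn_odd {d k : ℕ} (hd : d = 6 * k + 3) (hk : 1 ≤ k) : HasTwoPerColumn d := by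
  have hd' : (d : ℤ) = 6 * k + 3 := by exact_mod_cast hd
  obtain ⟨c, hc⟩ : ∃ c : ℤ → ℤ, ∀ j : ℤ, (j < 2 * k + 1 ∧ c j = 0) ∨
      (2 * k + 1 ≤ j ∧ j < 3 * k + 1 ∧ c j = 3 * k + 1) ∨
      (3 * k + 1 ≤ j ∧ j < 5 * k + 2 ∧ c j = 6 * k + 2) ∨
      (5 * k + 2 ≤ j ∧ c j = 3 * k + 1) :=
    ⟨fun j => if j < 2 * k + 1 then 0 else if j < 3 * k + 1 then 3 * k + 1 else
      if j < 5 * k + 2 then 6 * k + 2 else 3 * k + 1, fun j => by dsimp only; split_ifs <;> omega⟩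
  refine hasTwoPerColumn_of_int (fun j => 2 * j) (fun j => j + c j) (fun j => c j ≠ 3 * k + 1)
    ?_ ?_ ?_ ?_ ?_
  · intro i j t h0 hij hj ht
    rw [hd'] at hj ht
    obtain ⟨h1, h2⟩ := quotient_bounds (lo := 0) (hi := 2) (by omega) (by omega) (by omega) ht
    interval_cases t; omega
  · intro i j t h0 hij hj hi' hj' ht
    rw [hd'] at hj ht
    rcases hc i with hi | hi | hi | hi <;> rcases hc j with hj' | hj' | hj' | hj' <;>
      first
      | omega
      | obtain ⟨h1, h2⟩ := quotient_bounds (lo := -3) (hi := 3) (by omega) (by omega) (by omega) ht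
        interval_cases t <;> omega
  · intro i j t h0 hij hj hi' hj' ht
    rw [hd'] at hj ht
    obtain ⟨h1, h2⟩ := quotient_bounds (lo := -3) (hi := 3) (by omega) (by omega) (by omega) ht
    interval_cases t <;> omega
  · intro i j t h0 hij hj ht
    rw [hd'] at hj ht
    rcases hc i with hi | hi | hi | hi <;> rcases hc j with hj' | hj' | hj' | hj' <;>
      first
      | omega
      | obtain ⟨h1, h2⟩ := quotient_bounds (lo := -3) (hi := 5) (by omega) (by omega) (by omega) ht
        interval_cases t <;> omega
  · intro i j t h0 hij hj ht
    rw [hd'] at hj ht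
    rcases hc i with hi | hi | hi | hi <;> rcases hc j with hj' | hj' | hj' | hj' <;>
      first
      | omega
      | obtain ⟨h1, h2⟩ := quotient_bounds (lo := -3) (hi := 5) (by omega) (by omega) (by omega) ht
        interval_cases t <;> omega

theorem hasTwoPerColumn_twelve_mul {d k : ℕ} (hd : d = 12 * k) (hk : 1 ≤ k) :
    HasTwoPerColumn d := by
  have hd' : (d : ℤ) = 12 * k := by exact_mod_cast hd
  obtain ⟨c, hc⟩ : ∃ c : ℤ → ℤ, ∀ j : ℤ, (j < 4 * k ∧ c j = 0) ∨
      (4 * k ≤ j ∧ j < 6 * k - 1 ∧ c j = 6 * k + 1) ∨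
      (6 * k - 1 ≤ j ∧ j < 10 * k - 1 ∧ c j = 12 * k + 2) ∨ (10 * k - 1 ≤ j ∧ c j = 6 * k + 1) :=
    ⟨fun j => if j < 4 * k then 0 else if j < 6 * k - 1 then 6 * k + 1 else
      if j < 10 * k - 1 then 12 * k + 2 else 6 * k + 1,
      fun j => by dsimp only; split_ifs <;> omega⟩
  refine hasTwoPerColumn_of_int (fun j => j) (fun j => 2 * j + c j) (fun j => j < 6 * k - 1)
    ?_ ?_ ?_ ?_ ?_
  · intro i j t h0 hij hj ht
    rw [hd'] at hj ht
    obtain ⟨h1, h2⟩ := quotient_bounds (lo := 0) (hi := 1) (by omega) (by omega) (by omega) ht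
    omega
  all_goals
    intro i j t h0 hij hj
    first
    | intro hi' hj' ht
      rw [hd'] at hj ht
      rcases hc i with hi | hi | hi | hi <;> rcases hc j with hj' | hj' | hj' | hj' <;>
        first
        | omega
        | obtain ⟨h1, h2⟩ := quotient_bounds (lo := -3) (hi := 4) (by omega) (by omega)
            (by omega) ht
          interval_cases t <;> omega
    | intro ht
      rw [hd'] at hj ht
      rcases hc i with hi | hi | hi | hi <;> rcases hc j with hj' | hj' | hj' | hj' <;>
        first
        | omega
        | obtain ⟨h1, h2⟩ := quotient_bounds (lo := -4) (hi := 5) (by omega) (by omega)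
            (by omega) ht
          interval_cases t <;> omega

theorem hasTwoPerColumn_twelve_mul_add_six {d k : ℕ} (hd : d = 12 * k + 6) (hk : 1 ≤ k) :
    HasTwoPerColumn d := by
  have hd' : (d : ℤ) = 12 * k + 6 := by exact_mod_cast hd
  obtain ⟨c, hc⟩ : ∃ c : ℤ → ℤ, ∀ j : ℤ, (j < 4 * k + 2 ∧ c j = 0) ∨
      (4 * k + 2 ≤ j ∧ j < 6 * k + 1 ∧ c j = 6 * k + 5) ∨
      (6 * k + 1 ≤ j ∧ j < 10 * k + 3 ∧ c j = 12 * k + 10) ∨ (10 * k + 3 ≤ j ∧ c j = 6 * k + 5) :=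
    ⟨fun j => if j < 4 * k + 2 then 0 else if j < 6 * k + 1 then 6 * k + 5 else
      if j < 10 * k + 3 then 12 * k + 10 else 6 * k + 5,
      fun j => by dsimp only; split_ifs <;> omega⟩
  refine hasTwoPerColumn_of_int (fun j => j) (fun j => 2 * j + c j) (fun j => j < 6 * k + 1)
    ?_ ?_ ?_ ?_ ?_
  · intro i j t h0 hij hj ht
    rw [hd'] at hj ht
    obtain ⟨h1, h2⟩ := quotient_bounds (lo := 0) (hi := 1) (by omega) (by omega) (by omega) ht
    omega
  all_goals
    intro i j t h0 hij hj
    first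
    | intro hi' hj' ht
      rw [hd'] at hj ht
      rcases hc i with hi | hi | hi | hi <;> rcases hc j with hj' | hj' | hj' | hj' <;>
        first
        | omega
        | obtain ⟨h1, h2⟩ := quotient_bounds (lo := -3) (hi := 4) (by omega) (by omega)
            (by omega) ht
          interval_cases t <;> omega
    | intro ht
      rw [hd'] at hj ht
      rcases hc i with hi | hi | hi | hi <;> rcases hc j with hj' | hj' | hj' | hj' <;>
        first
        | omega
        | obtain ⟨h1, h2⟩ := quotient_bounds (lo := -4) (hi := 5) (by omega) (by omega)
            (by omega) ht
          interval_cases t <;> omega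

end IndependenceNumber

/-! ### Independence numbers of non-square boards -/

section NonsquareBoards

open Finset

variable {X Y R : Type*} [Fintype X] [Fintype Y] [Fintype R] [DecidableEq X] [DecidableEq Y]
  [DecidableEq R] [CommRing R] {G : SimpleGraph (X × Y)} {A : X → R} {B : Y → R} {a b : ℕ}

/-- The diagonals, one for each element of `R`, are cliques covering the board. -/
theorem IsQueenGraph.indepNum_le (h : IsQueenGraph G A B a b) : G.indepNum ≤ Fintype.card R := by
  obtain ⟨S, hS, hcard⟩ := G.exists_isNIndepSet_indepNum
  rw [← hcard, ← Finset.card_univ]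
  refine Finset.card_le_card_of_injOn (fun p => A p.1 - B p.2) (fun _ _ => Finset.mem_univ _) ?_
  intro p hp q hq hpq
  by_contra hne
  exact hS hp hq hne ((h.adj_iff p q).2 ⟨hne, Or.inr (Or.inr (Or.inl hpq))⟩)

/-- Diagonals only see residues, so a placement modulo d with at most `a` and `b` queens per residue
lifts to the board. -/
theorem IsQueenGraph.card_le_indepNum_of_maps (h : IsQueenGraph G A B a b) {ι : Type*} [Fintype ι]
    [DecidableEq ι] (x y : ι → R) (hx : ∀ r, #{i | x i = r} ≤ a) (hy : ∀ r, #{i | y i = r} ≤ b)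
    (hu : Function.Injective fun i => x i + y i) (hv : Function.Injective fun i => x i - y i) :
    Fintype.card ι ≤ G.indepNum := by
  obtain ⟨φ, hφ, hAφ⟩ := exists_injective_lift x A fun r => (hx r).trans (h.card_fst r).ge
  obtain ⟨ψ, hψ, hBψ⟩ := exists_injective_lift y B fun r => (hy r).trans (h.card_snd r).ge
  have hinj : Function.Injective fun i => (φ i, ψ i) := fun i j hij => hφ (congrArg Prod.fst hij)
  have hind : G.IsIndepSet (univ.map ⟨_, hinj⟩ : Finset (X × Y)) := by
    intro p hp q hq hne hadj
    simp only [coe_map, Function.Embedding.coeFn_mk, coe_univ, Set.image_univ,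
      Set.mem_range] at hp hq
    obtain ⟨i, rfl⟩ := hp
    obtain ⟨j, rfl⟩ := hq
    refine hne ?_
    obtain ⟨-, hadj | hadj | hadj | hadj⟩ := (h.adj_iff _ _).1 hadj
    · rw [hφ hadj]
    · rw [hψ hadj]
    · simp only [hAφ, hBψ] at hadj
      rw [hv hadj]
    · simp only [hAφ, hBψ] at hadj
      rw [hu hadj]
  have := hind.card_le_indepNum
  rwa [Finset.card_map, Finset.card_univ] at this

theorem hasTwoPerColumn {d : ℕ} (hd : d ≠ 3) (h0 : d ≠ 0) : HasTwoPerColumn d := by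
  by_cases h3 : 3 ∣ d
  · have h12 : d % 12 < 12 := Nat.mod_lt _ (by norm_num)
    rcases (by omega : d % 6 = 3 ∨ d % 12 = 0 ∨ d % 12 = 6) with h | h | h
    · exact hasTwoPerColumn_odd (k := d / 6) (by omega) (by omega)
    · exact hasTwoPerColumn_twelve_mul (k := d / 12) (by omega) (by omega)
    · by_cases h6 : d = 6
      · rw [h6]
        exact hasTwoPerColumn_six
      · exact hasTwoPerColumn_twelve_mul_add_six (k := d / 12) (by omega) (by omega)
  · exact hasTwoPerColumn_of_not_three_dvd h3

theorem indepNum_torus_le_gcd (m n : ℕ) [NeZero m] [NeZero n] :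
    (toroidalQueenGraph m n).indepNum ≤ Nat.gcd m n := by
  have : NeZero (Nat.gcd m n) := ⟨Nat.gcd_ne_zero_left (NeZero.ne m)⟩
  have h := isQueenGraph_torus rfl (Nat.gcd_dvd_left m n) (Nat.gcd_dvd_right m n)
  simpa using h.indepNum_le

theorem gcd_le_indepNum_torus {m n : ℕ} [NeZero m] [NeZero n] (hmn : m ≠ n)
    (h36 : ¬ (m = 3 ∧ n = 6)) (h63 : ¬ (m = 6 ∧ n = 3)) :
    Nat.gcd m n ≤ (toroidalQueenGraph m n).indepNum := by
  have hd0 : Nat.gcd m n ≠ 0 := Nat.gcd_ne_zero_left (NeZero.ne m)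
  obtain ⟨d, hd⟩ : ∃ d, d = Nat.gcd m n := ⟨_, rfl⟩
  rw [← hd] at hd0 ⊢
  have : NeZero d := ⟨hd0⟩
  have hdm : d ∣ m := hd ▸ Nat.gcd_dvd_left m n
  have hdn : d ∣ n := hd ▸ Nat.gcd_dvd_right m n
  have h := isQueenGraph_torus hd hdm hdn
  obtain ⟨a, ha⟩ := hdm
  obtain ⟨b, hb⟩ := hdn
  have hma : m / d = a := by rw [ha]; exact Nat.mul_div_cancel_left a (by omega)
  have hnb : n / d = b := by rw [hb]; exact Nat.mul_div_cancel_left b (by omega)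
  rw [hma, hnb] at h
  have ha0 : 1 ≤ a := Nat.one_le_iff_ne_zero.2 fun h0 => NeZero.ne m (by rw [ha, h0, mul_zero])
  have hb0 : 1 ≤ b := Nat.one_le_iff_ne_zero.2 fun h0 => NeZero.ne n (by rw [hb, h0, mul_zero])
  have hab : a ≠ b := fun hab => hmn (by rw [ha, hb, hab])
  obtain ⟨x, y, hx, hu, hv, hy⟩ : ∃ x y : Fin d → ZMod d, Function.Injective x ∧
      (Function.Injective fun i => x i + y i) ∧ (Function.Injective fun i => x i - y i) ∧
      ((∀ r, #{i | y i = r} ≤ a) ∨ (∀ r, #{i | y i = r} ≤ b)) := by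
    by_cases h3 : d = 3
    · subst h3
      -- Besides squares, only {a, b} = {1, 2} fails this, which is the excluded pair of sides 3 and
      -- 6. All three queens can then share one residue.
      have hab3 : 3 ≤ a ∨ 3 ≤ b := by omega
      refine ⟨fun i => (i : ℕ), fun _ => 0, ?_, ?_, ?_, ?_⟩
      · decide
      · decide
      · decide
      · have key : ∀ r : ZMod 3, #{i : Fin 3 | (0 : ZMod 3) = r} ≤ 3 := fun r => card_le_univ _
        exact hab3.imp (fun h r => (key r).trans h) (fun h r => (key r).trans h)
    · obtain ⟨x, y, hx, hy, hu, hv⟩ := hasTwoPerColumn h3 hd0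
      have hab2 : 2 ≤ a ∨ 2 ≤ b := by omega
      exact ⟨x, y, hx, hu, hv, hab2.imp (fun h r => (hy r).trans h) (fun h r => (hy r).trans h)⟩
  have hx' : ∀ c, 1 ≤ c → ∀ r, #{i | x i = r} ≤ c := fun c hc r =>
    (card_fiber_le_of_injective hx r).trans hc
  rw [← Fintype.card_fin d]
  -- The doubled coordinate goes on the longer side; swapping coordinates only negates differences.
  rcases hy with hy | hy
  · refine h.card_le_indepNum_of_maps y x hy (hx' b hb0) ?_ ?_
    · simpa only [add_comm] using hu
    · exact fun i j hij => hv (by simpa using congrArg Neg.neg hij)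
  · exact h.card_le_indepNum_of_maps x y (hx' a ha0) hy hu hv

theorem indepNum_torus_of_ne {m n : ℕ} [NeZero m] [NeZero n] (hmn : m ≠ n)
    (h36 : ¬ (m = 3 ∧ n = 6)) (h63 : ¬ (m = 6 ∧ n = 3)) :
    (toroidalQueenGraph m n).indepNum = Nat.gcd m n :=
  (indepNum_torus_le_gcd m n).antisymm (gcd_le_indepNum_torus hmn h36 h63)

/-- Read with s, t and s', t' the displacements of two queens from a third: all three agree in a
coordinate modulo 3, or two of them share a diagonal. -/
theorem three_residues : ∀ s t s' t' : ZMod 3, (s = 0 ∧ t = 0) ∨ (s' = 0 ∧ t' = 0) ∨ s = s' ∨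
    t = t' ∨ s - t = s' - t' ∨ s = -s' ∨ t = -t' ∨ s - t = -(s' - t') := by
  decide

theorem IsQueenGraph.indepNum_le_two {G : SimpleGraph (X × Y)} {A : X → ZMod 3} {B : Y → ZMod 3}
    (h : IsQueenGraph G A B a b) (ha : a ≤ 2) (hb : b ≤ 2) : G.indepNum ≤ 2 := by
  obtain ⟨S, hS, hcard⟩ := G.exists_isNIndepSet_indepNum
  by_contra hlt
  obtain ⟨p, hp, q, hq, r, hr, hpq, hpr, hqr⟩ := Finset.two_lt_card.1 (hcard ▸ not_le.1 hlt)
  have key : ∀ {p q}, p ∈ S → q ∈ S → p ≠ q → p.1 ≠ q.1 ∧ p.2 ≠ q.2 ∧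
      A p.1 - B p.2 ≠ A q.1 - B q.2 ∧ A p.1 + B p.2 ≠ A q.1 + B q.2 := fun {p q} hp hq hne => by
    have := mt (h.adj_iff p q).2 (hS hp hq hne)
    tauto
  obtain ⟨p1, p2, p3, p4⟩ := key hp hq hpq
  obtain ⟨q1, q2, q3, q4⟩ := key hp hr hpr
  obtain ⟨r1, r2, r3, r4⟩ := key hq hr hqr
  have hdec := three_residues (A p.1 - A q.1) (A p.1 - A r.1) (B p.2 - B q.2) (B p.2 - B r.2)
  simp only [sub_eq_zero] at hdec
  rcases hdec with ⟨h1, h2⟩ | ⟨h1, h2⟩ | e | e | e | e | e | e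
  · have := h.card_fst (A p.1)
    have : 2 < #{x | A x = A p.1} := Finset.two_lt_card.2
      ⟨p.1, by simp, q.1, by simp [h1], r.1, by simp [h2], p1, q1, r1⟩
    omega
  · have := h.card_snd (B p.2)
    have : 2 < #{x | B x = B p.2} := Finset.two_lt_card.2
      ⟨p.2, by simp, q.2, by simp [h1], r.2, by simp [h2], p2, q2, r2⟩
    omega
  · exact p3 (by linear_combination e)
  · exact q3 (by linear_combination e)
  · exact r3 (by linear_combination -e)
  · exact p4 (by linear_combination e)
  · exact q4 (by linear_combination e)
  · exact r4 (by linear_combination -e)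

theorem indepNum_torus_three_six : (toroidalQueenGraph 3 6).indepNum = 2 := by
  have h := isQueenGraph_torus (m := 3) (n := 6) (d := 3) (by decide) (by decide) (by decide)
  refine (h.indepNum_le_two (by decide) (by decide)).antisymm ?_
  have := h.card_le_indepNum_of_maps (ι := Fin 2) ![0, 1] ![0, 0] (by decide) (by decide)
    (by decide) (by decide)
  simpa using this

theorem indepNum_torus_six_three : (toroidalQueenGraph 6 3).indepNum = 2 := by
  have h := isQueenGraph_torus (m := 6) (n := 3) (d := 3) (by decide) (by decide) (by decide)
  refine (h.indepNum_le_two (by decide) (by decide)).antisymm ?_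
  have := h.card_le_indepNum_of_maps (ι := Fin 2) ![0, 0] ![0, 1] (by decide) (by decide)
    (by decide) (by decide)
  simpa using this

end NonsquareBoards

/-! ### Square boards: excluding n or n − 1 queens -/

section SquareBoardsUpperBound

open Finset

theorem torus_adj_iff {n : ℕ} [NeZero n] (p q : ZMod n × ZMod n) :
    (toroidalQueenGraph n n).Adj p q ↔ p ≠ q ∧ (p.1 = q.1 ∨ p.2 = q.2 ∨
      p.1 - p.2 = q.1 - q.2 ∨ p.1 + p.2 = q.1 + q.2) := by
  have h := isQueenGraph_torus (Nat.gcd_self n).symm dvd_rfl dvd_rfl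
  simpa [ZMod.castHom_self] using h.adj_iff p q

theorem injOn_of_isIndepSet {n : ℕ} [NeZero n] {S : Finset (ZMod n × ZMod n)}
    (hS : (toroidalQueenGraph n n).IsIndepSet S) :
    Set.InjOn Prod.fst (S : Set (ZMod n × ZMod n)) ∧ Set.InjOn Prod.snd (S : Set (ZMod n × ZMod n)) ∧
      Set.InjOn (fun p => p.1 - p.2) (S : Set (ZMod n × ZMod n)) ∧
      Set.InjOn (fun p => p.1 + p.2) (S : Set (ZMod n × ZMod n)) := by
  refine ⟨?_, ?_, ?_, ?_⟩ <;> intro p hp q hq hpq <;> by_contra hne <;>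
    refine hS hp hq hne ((torus_adj_iff p q).2 ⟨hne, ?_⟩)
  · exact Or.inl hpq
  · exact Or.inr (Or.inl hpq)
  · exact Or.inr (Or.inr (Or.inl hpq))
  · exact Or.inr (Or.inr (Or.inr hpq))

theorem image_eq_univ_of_injOn {P R : Type*} [Fintype R] [DecidableEq R] {S : Finset P} {f : P → R}
    (hf : Set.InjOn f (S : Set P)) (hS : #S = Fintype.card R) : S.image f = univ := by
  rw [← Finset.card_eq_iff_eq_univ, Finset.card_image_of_injOn hf, hS]

theorem exists_image_eq_erase_of_injOn {P R : Type*} [Fintype R] [DecidableEq R] {S : Finset P}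
    {f : P → R} (hf : Set.InjOn f (S : Set P)) (hS : #S + 1 = Fintype.card R) :
    ∃ r, S.image f = univ.erase r := by
  have h : #(S.image f)ᶜ = 1 := by
    rw [Finset.card_compl, Finset.card_image_of_injOn hf]
    omega
  obtain ⟨r, hr⟩ := Finset.card_eq_one.1 h
  refine ⟨r, ?_⟩
  rw [← compl_compl (S.image f), hr, Finset.compl_singleton]

theorem sum_univ_zmod {n : ℕ} [NeZero n] {M : Type*} [AddCommMonoid M] (g : ZMod n → M) :
    ∑ r, g r = ∑ i ∈ range n, g (i : ZMod n) :=
  Finset.sum_bij' (fun r _ => r.val) (fun i _ => (i : ZMod n))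
    (fun r _ => mem_range.2 (ZMod.val_lt r)) (fun _ _ => mem_univ _)
    (fun r _ => ZMod.natCast_zmod_val r)
    (fun i hi => ZMod.val_natCast_of_lt (mem_range.1 hi))
    (fun r _ => by rw [ZMod.natCast_zmod_val])

theorem six_mul_sum_range_sq (n : ℕ) :
    6 * ∑ i ∈ range n, (i : ℤ) ^ 2 = n * (n - 1) * (2 * n - 1) := by
  induction n with
  | zero => simp
  | succ n ih =>
    rw [Finset.sum_range_succ, mul_add, ih]
    push_cast
    ring

theorem two_mul_sum_range (n : ℕ) : 2 * ∑ i ∈ range n, (i : ℤ) = n * (n - 1) := by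
  induction n with
  | zero => simp
  | succ n ih =>
    rw [Finset.sum_range_succ, mul_add, ih]
    push_cast
    ring

/-- With n queens, x, y and x + y each run through ℤ/n, so τ + τ = τ for τ = n(n − 1)/2; but n does
not divide τ when n is even. -/
theorem card_ne_of_even {n : ℕ} [NeZero n] (hn : 2 ∣ n) {S : Finset (ZMod n × ZMod n)}
    (hS : (toroidalQueenGraph n n).IsIndepSet S) : #S ≠ n := by
  intro hcard
  obtain ⟨hx, hy, -, hu⟩ := injOn_of_isIndepSet hS
  have key : ∀ {f : ZMod n × ZMod n → ZMod n}, Set.InjOn f (S : Set (ZMod n × ZMod n)) →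
      ∑ p ∈ S, f p = ((∑ i ∈ range n, (i : ℤ) : ℤ) : ZMod n) := fun {f} hf => by
    have h := Finset.sum_image (f := id) hf
    rw [image_eq_univ_of_injOn hf (by rw [hcard, ZMod.card]), sum_univ_zmod] at h
    rw [Int.cast_sum]
    simpa using h.symm
  have h := key hu
  simp only [Finset.sum_add_distrib] at h
  rw [key hx, key hy, add_eq_left, ZMod.intCast_zmod_eq_zero_iff_dvd] at h
  obtain ⟨t, ht⟩ := h
  obtain ⟨k, rfl⟩ := hn
  have h2 := two_mul_sum_range (2 * k)
  rw [ht] at h2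
  have hk : (k : ℤ) ≠ 0 := by
    have := NeZero.ne (2 * k)
    omega
  push_cast at h2
  have h3 : 2 * t = 2 * k - 1 := mul_left_cancel₀ hk (by linarith)
  omega

/-- With n − 1 queens each of x, y, x + y, x − y misses one value. Summing coordinates expresses the
last two missing values through the first two, and summing (x + y)² + (x − y)² = 2x² + 2y² then
determines twice the sum of all squares. The modulus `M` may exceed n, as `hsq` makes squares of
residues modulo n well defined modulo `M`. -/
theorem dvd_two_mul_sum_sq {n M : ℕ} [NeZero n] (hsq : ∀ k l : ℤ, (n : ℤ) ∣ k - l →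
    (M : ℤ) ∣ k ^ 2 - l ^ 2) (hM : (M : ℤ) ∣ n * (n - 1) * ∑ i ∈ range n, (i : ℤ))
    (hM' : M ∣ 2 * n) {S : Finset (ZMod n × ZMod n)}
    (hS : (toroidalQueenGraph n n).IsIndepSet S) (hcard : #S + 1 = n) :
    (M : ℤ) ∣ 2 * ∑ i ∈ range n, (i : ℤ) ^ 2 := by
  obtain ⟨hx, hy, hv, hu⟩ := injOn_of_isIndepSet hS
  obtain ⟨q, hq⟩ : ∃ q : ZMod n → ZMod M, ∀ k : ℤ, q k = (k : ZMod M) ^ 2 := by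
    refine ⟨fun r => ((r.val : ℤ) : ZMod M) ^ 2, fun k => ?_⟩
    have h1 : (n : ℤ) ∣ ((k : ZMod n).val : ℤ) - k := by
      rw [← ZMod.intCast_zmod_eq_zero_iff_dvd]
      simp
    have h2 := (ZMod.intCast_zmod_eq_zero_iff_dvd _ _).2 (hsq _ _ h1)
    push_cast at h2
    exact sub_eq_zero.1 (by push_cast; exact h2)
  obtain ⟨τ, hτ⟩ : ∃ τ, τ = ∑ i ∈ range n, (i : ℤ) := ⟨_, rfl⟩
  obtain ⟨σ, hσ⟩ : ∃ σ, σ = ∑ i ∈ range n, (i : ℤ) ^ 2 := ⟨_, rfl⟩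
  have key : ∀ {f : ZMod n × ZMod n → ZMod n}, Set.InjOn f (S : Set (ZMod n × ZMod n)) →
      ∃ k : ℤ, (∑ p ∈ S, f p) + k = τ ∧ (∑ p ∈ S, q (f p)) + (k : ZMod M) ^ 2 = σ := fun {f} hf => by
    obtain ⟨r, hr⟩ := exists_image_eq_erase_of_injOn hf (by rw [hcard, ZMod.card])
    obtain ⟨k, rfl⟩ := ZMod.intCast_surjective r
    refine ⟨k, ?_, ?_⟩
    · have h := Finset.sum_image (f := id) hf
      simp only [id] at h
      rw [← h, hr, Finset.sum_erase_add _ _ (mem_univ _), sum_univ_zmod, hτ]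
      simp
    · rw [← hq, ← Finset.sum_image (f := q) hf, hr, Finset.sum_erase_add _ _ (mem_univ _),
        sum_univ_zmod, hσ]
      have : ∀ i : ℕ, q (i : ZMod n) = (i : ZMod M) ^ 2 := fun i => by simpa using hq i
      simp [this]
  obtain ⟨x, hx1, hx2⟩ := key hx
  obtain ⟨y, hy1, hy2⟩ := key hy
  obtain ⟨u, hu1, hu2⟩ := key hu
  obtain ⟨v, hv1, hv2⟩ := key hv
  simp only [Finset.sum_add_distrib, Finset.sum_sub_distrib] at hu1 hv1
  have hu3 : ((u : ℤ) : ZMod n) = ((x + y - τ : ℤ) : ZMod n) := by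
    push_cast
    linear_combination hu1 - hx1 - hy1
  have hv3 : ((v : ℤ) : ZMod n) = ((x - y + τ : ℤ) : ZMod n) := by
    push_cast
    linear_combination hv1 - hx1 + hy1
  have hpar : ∀ r s : ZMod n, q (r + s) + q (r - s) = 2 * q r + 2 * q s := fun r s => by
    obtain ⟨k, rfl⟩ := ZMod.intCast_surjective r
    obtain ⟨l, rfl⟩ := ZMod.intCast_surjective s
    rw [← Int.cast_add, ← Int.cast_sub, hq, hq, hq, hq]
    push_cast
    ring
  have hsum : ∑ p ∈ S, q (p.1 + p.2) + ∑ p ∈ S, q (p.1 - p.2) =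
      2 * ∑ p ∈ S, q p.1 + 2 * ∑ p ∈ S, q p.2 := by
    rw [Finset.mul_sum, Finset.mul_sum, ← Finset.sum_add_distrib, ← Finset.sum_add_distrib]
    exact Finset.sum_congr rfl fun p _ => hpar _ _
  have hu4 : (u : ZMod M) ^ 2 = ((x + y - τ : ℤ) : ZMod M) ^ 2 := by rw [← hq, hu3, hq]
  have hv4 : (v : ZMod M) ^ 2 = ((x - y + τ : ℤ) : ZMod M) ^ 2 := by rw [← hq, hv3, hq]
  have h2n : ((2 * n : ℕ) : ZMod M) = 0 := (ZMod.natCast_eq_zero_iff _ _).2 hM'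
  have hτ' : 2 * (τ : ZMod M) = n * (n - 1) := by
    have := two_mul_sum_range n
    rw [← hτ] at this
    exact_mod_cast congrArg (Int.cast : ℤ → ZMod M) this
  have hτ'' : (n : ZMod M) * (n - 1) * τ = 0 := by
    rw [← hτ] at hM
    have := (ZMod.intCast_zmod_eq_zero_iff_dvd _ _).2 hM
    exact_mod_cast this
  -- With u = x + y − τ and v = x − y + τ the identity reduces to 2σ = 4yτ − 2τ², where 2τ = n(n −
  -- 1); `hM'` and `hM` kill the two terms.
  rw [← hσ, ← ZMod.intCast_zmod_eq_zero_iff_dvd]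
  push_cast at hu4 hv4 h2n ⊢
  linear_combination hu2 + hv2 - 2 * hx2 - 2 * hy2 - hsum - hu4 - hv4 - τ * hτ' - hτ'' +
    2 * y * hτ' + y * (n - 1) * h2n

theorem card_add_one_ne {n : ℕ} [NeZero n] (hn : 3 ∣ n ∨ 4 ∣ n) {S : Finset (ZMod n × ZMod n)}
    (hS : (toroidalQueenGraph n n).IsIndepSet S) : #S + 1 ≠ n := by
  intro hcard
  have h6 := six_mul_sum_range_sq n
  have hn0 : (n : ℤ) ≠ 0 := by exact_mod_cast NeZero.ne n
  rcases hn with hn | hn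
  -- Twice the sum of squares is n(n − 1)(2n − 1)/3, so n dividing it would give 3 ∣ (n − 1)(2n −
  -- 1), impossible for 3 ∣ n.
  · obtain ⟨t, ht⟩ := dvd_two_mul_sum_sq (M := n) (fun k l h => by
      rw [sq_sub_sq]
      exact h.mul_left _) ((dvd_mul_right _ _).mul_right _) (dvd_mul_left _ _) hS hcard
    have h3 : 3 * t = (n - 1) * (2 * n - 1) := mul_left_cancel₀ hn0 (by linarith)
    obtain ⟨e, rfl⟩ := hn
    push_cast at h3
    have h4 : 3 * (t - (6 * e * e - 3 * e)) = (1 : ℤ) := by linarith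
    omega
  -- Squares modulo 2n depend only on the residue modulo the even number n; working modulo 2n makes
  -- (n − 1)(2n − 1) even, though both factors are odd.
  · obtain ⟨e, rfl⟩ := hn
    have h2 := two_mul_sum_range (4 * e)
    push_cast at h2 h6 hn0
    obtain ⟨t, ht⟩ := dvd_two_mul_sum_sq (M := 2 * (4 * e)) (fun k l h => by
      obtain ⟨s, hs⟩ := h
      obtain rfl : k = l + (4 * e : ℕ) * s := by linarith
      exact ⟨s * l + 2 * e * s ^ 2, by push_cast; ring⟩)
      ⟨(4 * e - 1) * e * (4 * e - 1), by push_cast; linear_combination 2 * e * (4 * e - 1) * h2⟩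
      dvd_rfl hS hcard
    push_cast at ht
    have h3 : 6 * t = (4 * e - 1) * (2 * (4 * e) - 1) := mul_left_cancel₀ hn0 (by linarith)
    have h4 : 2 * (3 * t - (16 * e * e - 6 * e)) = (1 : ℤ) := by linarith
    omega

theorem indepNum_le_of_forall_card_ne {V : Type*} [Fintype V] {G : SimpleGraph V} {k : ℕ}
    (h : ∀ S : Finset V, G.IsIndepSet S → #S ≠ k + 1) : G.indepNum ≤ k := by
  obtain ⟨S, hS, hcard⟩ := G.exists_isNIndepSet_indepNum
  by_contra hlt
  obtain ⟨T, hTS, hT⟩ := Finset.exists_subset_card_eq (s := S) (n := k + 1) (by omega)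
  exact h T (hS.mono hTS) hT

theorem indepNum_torus_square_add_one_le {n : ℕ} [NeZero n] (hn : 2 ∣ n) :
    (toroidalQueenGraph n n).indepNum ≤ n - 1 :=
  indepNum_le_of_forall_card_ne fun S hS hcard => card_ne_of_even hn hS (by
    have := NeZero.ne n
    omega)

theorem indepNum_torus_square_add_two_le {n : ℕ} [NeZero n] (h2 : 2 ≤ n) (hn : 3 ∣ n ∨ 4 ∣ n) :
    (toroidalQueenGraph n n).indepNum ≤ n - 2 :=
  indepNum_le_of_forall_card_ne fun S hS hcard => card_add_one_ne hn hS (by omega)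

end SquareBoardsUpperBound

/-! ### Square boards: placements of n and n − 1 queens -/

section SquareBoardsLowerBound

open Finset

theorem card_le_indepNum_of_int {n : ℕ} [NeZero n] (J : Finset ℤ) (y : ℤ → ℤ)
    (hJ : ∀ i ∈ J, 0 ≤ i ∧ i < n)
    (hy : ∀ i ∈ J, ∀ j ∈ J, i < j → ∀ t, y j - y i ≠ n * t)
    (hu : ∀ i ∈ J, ∀ j ∈ J, i < j → ∀ t, (y j + j) - (y i + i) ≠ n * t)
    (hv : ∀ i ∈ J, ∀ j ∈ J, i < j → ∀ t, (y j - j) - (y i - i) ≠ n * t) :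
    #J ≤ (toroidalQueenGraph n n).indepNum := by
  have key : ∀ f : ℤ → ℤ, (∀ i ∈ J, ∀ j ∈ J, i < j → ∀ t, f j - f i ≠ n * t) →
      ∀ i ∈ J, ∀ j ∈ J, (f i : ZMod n) = f j → i = j := by
    intro f hf i hi j hj hij
    rcases lt_trichotomy i j with hlt | heq | hlt
    · obtain ⟨t, ht⟩ := (ZMod.intCast_eq_intCast_iff_dvd_sub _ _ _).1 hij
      exact absurd ht (hf i hi j hj hlt t)
    · exact heq
    · obtain ⟨t, ht⟩ := (ZMod.intCast_eq_intCast_iff_dvd_sub _ _ _).1 hij.symm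
      exact absurd ht (hf j hj i hi hlt t)
  have hx : ∀ i ∈ J, ∀ j ∈ J, i < j → ∀ t, j - i ≠ n * t := by
    intro i hi j hj hij t ht
    have hi' := hJ i hi
    have hj' := hJ j hj
    obtain ⟨h1, h2⟩ := quotient_bounds (lo := 0) (hi := 1) (by omega) (by omega) (by omega) ht
    omega
  have hx' := key (fun i => i) hx
  have hy' := key y hy
  have hu' := key (fun i => y i + i) hu
  have hv' := key (fun i => y i - i) hv
  have hinj : Set.InjOn (fun i : ℤ => ((i : ZMod n), (y i : ZMod n))) (J : Set ℤ) :=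
    fun i hi j hj hij => hx' i hi j hj (congrArg Prod.fst hij)
  rw [← Finset.card_image_of_injOn hinj]
  refine SimpleGraph.IsIndepSet.card_le_indepNum fun p hp q hq hne hadj => hne ?_
  simp only [coe_image, Set.mem_image, mem_coe] at hp hq
  obtain ⟨i, hi, rfl⟩ := hp
  obtain ⟨j, hj, rfl⟩ := hq
  suffices i = j by rw [this]
  obtain ⟨-, h | h | h | h⟩ := (torus_adj_iff _ _).1 hadj
  · exact hx' i hi j hj h
  · exact hy' i hi j hj h
  · refine hv' i hi j hj ?_
    push_cast
    simp only at h
    linear_combination -h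
  · refine hu' i hi j hj ?_
    push_cast
    simp only at h
    linear_combination h

theorem card_Ico_sdiff_pair {n : ℕ} {g h : ℤ} (hg : 0 ≤ g) (hgh : g < h) (hh : h < n) :
    #(Finset.Ico (0 : ℤ) n \ {g, h}) = n - 2 := by
  rw [Finset.card_sdiff_of_subset, Int.card_Ico, Finset.card_pair hgh.ne]
  · simp
  · intro i hi
    simp only [mem_insert, mem_singleton] at hi
    simp only [Finset.mem_Ico]
    omega

theorem sub_two_le_indepNum_of_int {n : ℕ} [NeZero n] {g h : ℤ} (hg : 0 ≤ g) (hgh : g < h)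
    (hh : h < n) (y : ℤ → ℤ)
    (hy : ∀ i j, 0 ≤ i → i ≠ g → i ≠ h → j ≠ g → j ≠ h → i < j → j < n →
      ∀ t, y j - y i ≠ n * t)
    (hu : ∀ i j, 0 ≤ i → i ≠ g → i ≠ h → j ≠ g → j ≠ h → i < j → j < n →
      ∀ t, (y j + j) - (y i + i) ≠ n * t)
    (hv : ∀ i j, 0 ≤ i → i ≠ g → i ≠ h → j ≠ g → j ≠ h → i < j → j < n →
      ∀ t, (y j - j) - (y i - i) ≠ n * t) :
    n - 2 ≤ (toroidalQueenGraph n n).indepNum := by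
  have hmem : ∀ i, i ∈ Finset.Ico (0 : ℤ) n \ {g, h} ↔ (0 ≤ i ∧ i < n) ∧ i ≠ g ∧ i ≠ h := by
    intro i
    simp
  rw [← card_Ico_sdiff_pair hg hgh hh]
  refine card_le_indepNum_of_int _ y (fun i hi => ((hmem i).1 hi).1) ?_ ?_ ?_ <;>
    intro i hi j hj hij t <;> obtain ⟨hi, hi'⟩ := (hmem i).1 hi <;> obtain ⟨hj, hj'⟩ := (hmem j).1 hj
  · exact hy i j hi.1 hi'.1 hi'.2 hj'.1 hj'.2 hij hj.2 t
  · exact hu i j hi.1 hi'.1 hi'.2 hj'.1 hj'.2 hij hj.2 t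
  · exact hv i j hi.1 hi'.1 hi'.2 hj'.1 hj'.2 hij hj.2 t

theorem ne_mul_of_bounds {n w : ℤ} (lo hi : ℤ) (hn : 0 < n) (hlo : n * lo < w) (hhi : w < n * hi)
    (h : ∀ t, lo < t → t < hi → w ≠ n * t) (t : ℤ) : w ≠ n * t := fun ht =>
  h t (quotient_bounds hn hlo hhi ht).1 (quotient_bounds hn hlo hhi ht).2 ht

/-- For y = 2x the sums and differences are 3x and x, and 1, 2, 3 are units modulo n. -/
theorem le_indepNum_square_of_coprime_six {n : ℕ} [NeZero n] (h : Nat.gcd 6 n = 1) :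
    n ≤ (toroidalQueenGraph n n).indepNum := by
  have h6 : IsCoprime (6 : ℤ) n := by exact_mod_cast Nat.isCoprime_iff_coprime.2 h
  have key : ∀ c : ℤ, c ∣ 6 → ∀ i ∈ Finset.Ico (0 : ℤ) n, ∀ j ∈ Finset.Ico (0 : ℤ) n, i < j → ∀ t,
      c * j - c * i ≠ n * t := fun c hc i hi j hj hij t =>
    ne_mul_of_coprime (h6.of_isCoprime_of_dvd_left hc) (Finset.mem_Ico.1 hi).1 hij
      (Finset.mem_Ico.1 hj).2
  have := card_le_indepNum_of_int (n := n) (Finset.Ico 0 n) (fun i => 2 * i)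
    (fun i hi => Finset.mem_Ico.1 hi) (key 2 (by norm_num)) ?_ ?_
  · simpa using this
  · intro i hi j hj hij t ht
    exact key 3 (by norm_num) i hi j hj hij t (by linear_combination ht)
  · intro i hi j hj hij t ht
    exact key 1 (by norm_num) i hi j hj hij t (by linear_combination ht)

/-- i + c i skips only n/2, and 3 is a unit. The maps 4i + 3 c i and 2i + 3 c i are injective on
each half, as n/2 is odd, and the shift by 3 separates the halves by parity. -/
theorem sub_one_le_indepNum_square {n : ℕ} [NeZero n] (h3 : ¬ 3 ∣ n) (h2 : 2 ∣ n) (h4 : ¬ 4 ∣ n) :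
    n - 1 ≤ (toroidalQueenGraph n n).indepNum := by
  obtain ⟨k, hk⟩ : ∃ k : ℕ, n = 4 * k + 2 := ⟨n / 4, by omega⟩
  have hn : (n : ℤ) = 4 * k + 2 := by exact_mod_cast hk
  obtain ⟨c, hc⟩ : ∃ c : ℤ → ℤ, ∀ i : ℤ, (i < 2 * k + 1 ∧ c i = 0) ∨ (2 * k + 1 ≤ i ∧ c i = 1) :=
    ⟨fun i => if i < 2 * k + 1 then 0 else 1, fun i => by dsimp only; split_ifs <;> omega⟩
  have := card_le_indepNum_of_int (n := n) (Finset.Ico 0 (n - 1)) (fun i => 3 * (i + c i))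
    (fun i hi => by rw [Finset.mem_Ico] at hi; omega) ?_ ?_ ?_
  · simp only [Int.card_Ico] at this
    omega
  all_goals
    intro i hi j hj hij t ht
    simp only [Finset.mem_Ico] at hi hj
  · have h1 : (n : ℤ) ∣ 3 * ((j + c j) - (i + c i)) := ⟨t, by linear_combination ht⟩
    have h2 := Int.le_of_dvd (by rcases hc i with h | h <;> rcases hc j with h' | h' <;> omega)
      ((isCoprime_three h3).symm.dvd_of_dvd_mul_left h1)
    rcases hc i with h | h <;> rcases hc j with h' | h' <;> omega
  · revert t
    change ∀ t, _ ≠ _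
    rw [hn] at hi hj ⊢
    refine ne_mul_of_bounds 0 4 (by omega) ?_ ?_ fun t h1 h2 => ?_
    · rcases hc i with h | h <;> rcases hc j with h' | h' <;> omega
    · rcases hc i with h | h <;> rcases hc j with h' | h' <;> omega
    · interval_cases t <;> rcases hc i with h | h <;> rcases hc j with h' | h' <;> omega
  · revert t
    change ∀ t, _ ≠ _
    rw [hn] at hi hj ⊢
    refine ne_mul_of_bounds 0 2 (by omega) ?_ ?_ fun t h1 h2 => ?_
    · rcases hc i with h | h <;> rcases hc j with h' | h' <;> omega
    · rcases hc i with h | h <;> rcases hc j with h' | h' <;> omega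
    · interval_cases t; rcases hc i with h | h <;> rcases hc j with h' | h' <;> omega

end SquareBoardsLowerBound

/-! ### Square boards: placements of n − 2 queens -/

section SquareBoardsLowerBound

/-- The linear rule 2i has sums 3i, three-to-one modulo n. The shifts −2, −1, 0 are distinct modulo
3, and each is used on indices distinct modulo n/3; the two omitted columns make room for the
breaks. -/
theorem sub_two_le_indepNum_square_odd {n k : ℕ} [NeZero n]
    (hn : n = 6 * k + 3) (hk : 1 ≤ k) :
    n - 2 ≤ (toroidalQueenGraph n n).indepNum := by
  have hn' : (n : ℤ) = 6 * k + 3 := by exact_mod_cast hn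
  obtain ⟨c, hc⟩ : ∃ c : ℤ → ℤ, ∀ i : ℤ,
      i ≠ 5 * k + 2 → i ≠ 6 * k + 2 → i < 6 * k + 3 →
      (i < 2 * k + 1 ∧ c i = -2) ∨ (2 * k + 1 ≤ i ∧ i < 3 * k + 1 ∧ c i = -1) ∨
      (3 * k + 1 ≤ i ∧ i < 5 * k + 2 ∧ c i = 0) ∨ (5 * k + 3 ≤ i ∧ i < 6 * k + 2 ∧ c i = -1) :=
    ⟨fun i =>
        if i < 2 * k + 1 then -2 else if i < 3 * k + 1 then -1 else
        if i < 5 * k + 2 then 0 else -1,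
      fun i _ _ _ => by dsimp only; split_ifs <;> omega⟩
  refine sub_two_le_indepNum_of_int (g := 5 * k + 2) (h := 6 * k + 2) (by omega) (by omega)
    (by omega) (fun i => 2 * i + c i) ?_ ?_ ?_
  all_goals
    intro i j h0 hig hih hjg hjh hij hjn
    rw [hn'] at hjn ⊢
    rcases hc i hig hih (hij.trans hjn) with hi | hi | hi | hi <;>
      rcases hc j hjg hjh hjn with hj | hj | hj | hj <;>
      clear hc hig hih hjg hjh hjn <;>
      first
      | exfalso; omega
      | refine ne_mul_of_bounds 0 1 (by omega) ?_ ?_ ?_ <;>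
          [omega; omega; (intro t h1 h2; omega)]
      | refine ne_mul_of_bounds 0 2 (by omega) ?_ ?_ ?_ <;>
          [omega; omega; (intro t h1 h2; interval_cases t; omega)]
      | refine ne_mul_of_bounds 1 3 (by omega) ?_ ?_ ?_ <;>
          [omega; omega; (intro t h1 h2; interval_cases t; omega)]
      | refine ne_mul_of_bounds 0 3 (by omega) ?_ ?_ ?_ <;>
          [omega; omega; (intro t h1 h2; interval_cases t <;> omega)]

/-- For the rule 3i the sums are 4i, four-to-one modulo n. The shifts 0, −1, 1, 2 are distinct
modulo 4, each used on indices distinct modulo n/4. The case 12k + 4 works alike. -/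
theorem sub_two_le_indepNum_square_twelve_mul_add_eight {n k : ℕ} [NeZero n]
    (hn : n = 12 * k + 8) :
    n - 2 ≤ (toroidalQueenGraph n n).indepNum := by
  have hn' : (n : ℤ) = 12 * k + 8 := by exact_mod_cast hn
  obtain ⟨c, hc⟩ : ∃ c : ℤ → ℤ, ∀ i : ℤ,
      i ≠ 7 * k + 4 → i ≠ 12 * k + 7 → i < 12 * k + 8 →
      (i < 3 * k + 2 ∧ c i = 0) ∨ (3 * k + 2 ≤ i ∧ i < 4 * k + 3 ∧ c i = -1) ∨
      (4 * k + 3 ≤ i ∧ i < 7 * k + 4 ∧ c i = 1) ∨ (7 * k + 5 ≤ i ∧ i < 9 * k + 6 ∧ c i = -1) ∨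
      (9 * k + 6 ≤ i ∧ i < 12 * k + 7 ∧ c i = 2) :=
    ⟨fun i =>
        if i < 3 * k + 2 then 0 else if i < 4 * k + 3 then -1 else if i < 7 * k + 4 then 1 else
        if i < 9 * k + 6 then -1 else 2,
      fun i _ _ _ => by dsimp only; split_ifs <;> omega⟩
  refine sub_two_le_indepNum_of_int (g := 7 * k + 4) (h := 12 * k + 7) (by omega) (by omega)
    (by omega) (fun i => 3 * i + c i) ?_ ?_ ?_
  all_goals
    intro i j h0 hig hih hjg hjh hij hjn
    rw [hn'] at hjn ⊢
    rcases hc i hig hih (hij.trans hjn) with hi | hi | hi | hi | hi <;>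
      rcases hc j hjg hjh hjn with hj | hj | hj | hj | hj <;>
      clear hc hig hih hjg hjh hjn <;>
      first
      | exfalso; omega
      | refine ne_mul_of_bounds 0 1 (by omega) ?_ ?_ ?_ <;>
          [omega; omega; (intro t h1 h2; omega)]
      | refine ne_mul_of_bounds 0 2 (by omega) ?_ ?_ ?_ <;>
          [omega; omega; (intro t h1 h2; interval_cases t; omega)]
      | refine ne_mul_of_bounds 1 3 (by omega) ?_ ?_ ?_ <;>
          [omega; omega; (intro t h1 h2; interval_cases t; omega)]
      | refine ne_mul_of_bounds 0 3 (by omega) ?_ ?_ ?_ <;>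
          [omega; omega; (intro t h1 h2; interval_cases t <;> omega)]
      | refine ne_mul_of_bounds 2 4 (by omega) ?_ ?_ ?_ <;>
          [omega; omega; (intro t h1 h2; interval_cases t; omega)]

theorem sub_two_le_indepNum_square_twelve_mul_add_four {n k : ℕ} [NeZero n]
    (hn : n = 12 * k + 4) :
    n - 2 ≤ (toroidalQueenGraph n n).indepNum := by
  have hn' : (n : ℤ) = 12 * k + 4 := by exact_mod_cast hn
  obtain ⟨c, hc⟩ : ∃ c : ℤ → ℤ, ∀ i : ℤ,
      i ≠ 4 * k + 1 → i ≠ 9 * k + 3 → i < 12 * k + 4 →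
      (i < 3 * k + 1 ∧ c i = 0) ∨ (3 * k + 1 ≤ i ∧ i < 4 * k + 1 ∧ c i = 1) ∨
      (4 * k + 2 ≤ i ∧ i < 7 * k + 3 ∧ c i = -1) ∨ (7 * k + 3 ≤ i ∧ i < 9 * k + 3 ∧ c i = 1) ∨
      (9 * k + 4 ≤ i ∧ i < 12 * k + 4 ∧ c i = -2) :=
    ⟨fun i =>
        if i < 3 * k + 1 then 0 else if i < 4 * k + 1 then 1 else if i < 7 * k + 3 then -1 else
        if i < 9 * k + 3 then 1 else -2,
      fun i _ _ _ => by dsimp only; split_ifs <;> omega⟩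
  refine sub_two_le_indepNum_of_int (g := 4 * k + 1) (h := 9 * k + 3) (by omega) (by omega)
    (by omega) (fun i => 3 * i + c i) ?_ ?_ ?_
  all_goals
    intro i j h0 hig hih hjg hjh hij hjn
    rw [hn'] at hjn ⊢
    rcases hc i hig hih (hij.trans hjn) with hi | hi | hi | hi | hi <;>
      rcases hc j hjg hjh hjn with hj | hj | hj | hj | hj <;>
      clear hc hig hih hjg hjh hjn <;>
      first
      | exfalso; omega
      | refine ne_mul_of_bounds 0 1 (by omega) ?_ ?_ ?_ <;>
          [omega; omega; (intro t h1 h2; omega)]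
      | refine ne_mul_of_bounds 0 2 (by omega) ?_ ?_ ?_ <;>
          [omega; omega; (intro t h1 h2; interval_cases t; omega)]
      | refine ne_mul_of_bounds 1 3 (by omega) ?_ ?_ ?_ <;>
          [omega; omega; (intro t h1 h2; interval_cases t; omega)]
      | refine ne_mul_of_bounds 0 3 (by omega) ?_ ?_ ?_ <;>
          [omega; omega; (intro t h1 h2; interval_cases t <;> omega)]
      | refine ne_mul_of_bounds 2 4 (by omega) ?_ ?_ ?_ <;>
          [omega; omega; (intro t h1 h2; interval_cases t; omega)]

/-- Here 3 also divides n, so the shifts must separate coinciding values of 3i as well as of 4i and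
2i; hence the additional block. -/
theorem sub_two_le_indepNum_square_twelve_mul {n k : ℕ} [NeZero n]
    (hn : n = 12 * k) (hk : 1 ≤ k) :
    n - 2 ≤ (toroidalQueenGraph n n).indepNum := by
  have hn' : (n : ℤ) = 12 * k := by exact_mod_cast hn
  obtain ⟨c, hc⟩ : ∃ c : ℤ → ℤ, ∀ i : ℤ,
      i ≠ 11 * k - 2 → i ≠ 12 * k - 1 → i < 12 * k →
      (i < 3 * k ∧ c i = 0) ∨ (3 * k ≤ i ∧ i < 5 * k ∧ c i = -1) ∨
      (5 * k ≤ i ∧ i < 6 * k ∧ c i = -2) ∨ (6 * k ≤ i ∧ i < 9 * k - 1 ∧ c i = 1) ∨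
      (9 * k - 1 ≤ i ∧ i < 11 * k - 2 ∧ c i = 2) ∨ (11 * k - 1 ≤ i ∧ i < 12 * k - 1 ∧ c i = 3) :=
    ⟨fun i =>
        if i < 3 * k then 0 else if i < 5 * k then -1 else if i < 6 * k then -2 else
        if i < 9 * k - 1 then 1 else if i < 11 * k - 2 then 2 else 3,
      fun i _ _ _ => by dsimp only; split_ifs <;> omega⟩
  refine sub_two_le_indepNum_of_int (g := 11 * k - 2) (h := 12 * k - 1) (by omega) (by omega)
    (by omega) (fun i => 3 * i + c i) ?_ ?_ ?_
  all_goals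
    intro i j h0 hig hih hjg hjh hij hjn
    rw [hn'] at hjn ⊢
    rcases hc i hig hih (hij.trans hjn) with hi | hi | hi | hi | hi | hi <;>
      rcases hc j hjg hjh hjn with hj | hj | hj | hj | hj | hj <;>
      clear hc hig hih hjg hjh hjn <;>
      first
      | exfalso; omega
      | refine ne_mul_of_bounds 0 1 (by omega) ?_ ?_ ?_ <;>
          [omega; omega; (intro t h1 h2; omega)]
      | refine ne_mul_of_bounds 0 2 (by omega) ?_ ?_ ?_ <;>
          [omega; omega; (intro t h1 h2; interval_cases t; omega)]
      | refine ne_mul_of_bounds 1 3 (by omega) ?_ ?_ ?_ <;>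
          [omega; omega; (intro t h1 h2; interval_cases t; omega)]
      | refine ne_mul_of_bounds 0 3 (by omega) ?_ ?_ ?_ <;>
          [omega; omega; (intro t h1 h2; interval_cases t <;> omega)]
      | refine ne_mul_of_bounds 2 4 (by omega) ?_ ?_ ?_ <;>
          [omega; omega; (intro t h1 h2; interval_cases t; omega)]

theorem sub_two_le_indepNum_square_twelve_mul_add_six {n k : ℕ} [NeZero n]
    (hn : n = 12 * k + 6) (hk : 1 ≤ k) :
    n - 2 ≤ (toroidalQueenGraph n n).indepNum := by
  have hn' : (n : ℤ) = 12 * k + 6 := by exact_mod_cast hn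
  obtain ⟨c, hc⟩ : ∃ c : ℤ → ℤ, ∀ i : ℤ,
      i ≠ 6 * k + 3 → i ≠ 10 * k + 5 → i < 12 * k + 6 →
      (i < 2 ∧ c i = 0) ∨ (2 ≤ i ∧ i < 4 * k + 4 ∧ c i = -7) ∨
      (4 * k + 4 ≤ i ∧ i < 6 * k + 3 ∧ c i = 0) ∨ (6 * k + 4 ≤ i ∧ i < 10 * k + 5 ∧ c i = 4) ∨
      (10 * k + 6 ≤ i ∧ i < 12 * k + 6 ∧ c i = -3) :=
    ⟨fun i =>
        if i < 2 then 0 else if i < 4 * k + 4 then -7 else if i < 6 * k + 3 then 0 else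
        if i < 10 * k + 5 then 4 else -3,
      fun i _ _ _ => by dsimp only; split_ifs <;> omega⟩
  refine sub_two_le_indepNum_of_int (g := 6 * k + 3) (h := 10 * k + 5) (by omega) (by omega)
    (by omega) (fun i => 3 * i + c i) ?_ ?_ ?_
  all_goals
    intro i j h0 hig hih hjg hjh hij hjn
    rw [hn'] at hjn ⊢
    rcases hc i hig hih (hij.trans hjn) with hi | hi | hi | hi | hi <;>
      rcases hc j hjg hjh hjn with hj | hj | hj | hj | hj <;>
      clear hc hig hih hjg hjh hjn <;>
      first
      | exfalso; omega
      | refine ne_mul_of_bounds 0 1 (by omega) ?_ ?_ ?_ <;>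
          [omega; omega; (intro t h1 h2; omega)]
      | refine ne_mul_of_bounds 0 2 (by omega) ?_ ?_ ?_ <;>
          [omega; omega; (intro t h1 h2; interval_cases t; omega)]
      | refine ne_mul_of_bounds (-1) 1 (by omega) ?_ ?_ ?_ <;>
          [omega; omega; (intro t h1 h2; interval_cases t; omega)]
      | refine ne_mul_of_bounds 1 3 (by omega) ?_ ?_ ?_ <;>
          [omega; omega; (intro t h1 h2; interval_cases t; omega)]
      | refine ne_mul_of_bounds (-1) 2 (by omega) ?_ ?_ ?_ <;>
          [omega; omega; (intro t h1 h2; interval_cases t <;> omega)]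
      | refine ne_mul_of_bounds 2 4 (by omega) ?_ ?_ ?_ <;>
          [omega; omega; (intro t h1 h2; interval_cases t; omega)]
      | refine ne_mul_of_bounds 0 4 (by omega) ?_ ?_ ?_ <;>
          [omega; omega; (intro t h1 h2; interval_cases t <;> omega)]

end SquareBoardsLowerBound

/-! ### Square boards: the independence number, and the gonality -/

section SquareBoards

theorem sub_two_le_indepNum_square {n : ℕ} [NeZero n] (h2 : 2 ≤ n) (hn : 3 ∣ n ∨ 4 ∣ n) :
    n - 2 ≤ (toroidalQueenGraph n n).indepNum := by
  have hmaps : ∀ k : ℕ, [NeZero k] → IsQueenGraph (toroidalQueenGraph k k)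
      (ZMod.castHom dvd_rfl (ZMod k)) (ZMod.castHom dvd_rfl (ZMod k)) (k / k) (k / k) :=
    fun k => isQueenGraph_torus (Nat.gcd_self k).symm dvd_rfl dvd_rfl
  -- The families with n ≡ 3 mod 6 and n ≡ 6 mod 12 need k ≥ 1, so sides 3 and 6 get placements of
  -- their own.
  rcases (by omega : n = 3 ∨ n = 6 ∨ n % 6 = 3 ∧ 9 ≤ n ∨ n % 12 = 8 ∨ n % 12 = 4 ∨
    n % 12 = 0 ∨ n % 12 = 6 ∧ 18 ≤ n) with rfl | rfl | h | h | h | h | h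
  · have := (hmaps 3).card_le_indepNum_of_maps (ι := Fin 1) ![0] ![0] (by decide) (by decide)
      (by decide) (by decide)
    simpa using this
  · have := (hmaps 6).card_le_indepNum_of_maps (ι := Fin 4) ![0, 1, 2, 3] ![0, 2, 5, 1]
      (by decide) (by decide) (by decide) (by decide)
    simpa using this
  · exact sub_two_le_indepNum_square_odd (k := n / 6) (by omega) (by omega)
  · exact sub_two_le_indepNum_square_twelve_mul_add_eight (k := n / 12) (by omega)
  · exact sub_two_le_indepNum_square_twelve_mul_add_four (k := n / 12) (by omega)
  · exact sub_two_le_indepNum_square_twelve_mul (k := n / 12) (by omega) (by omega)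
  · exact sub_two_le_indepNum_square_twelve_mul_add_six (k := n / 12) (by omega) (by omega)

theorem indepNum_torus_square {n : ℕ} [NeZero n] (hn : 2 ≤ n) :
    (toroidalQueenGraph n n).indepNum =
      if Nat.gcd 6 n = 1 then n else if ¬ 3 ∣ n ∧ ¬ 4 ∣ n then n - 1 else n - 2 := by
  split_ifs with h6 h
  · refine le_antisymm ?_ (le_indepNum_square_of_coprime_six h6)
    simpa using indepNum_torus_le_gcd n n
  · have h2 : 2 ∣ n := by
      by_contra h2
      refine h6 ?_
      have c2 := (Nat.Prime.coprime_iff_not_dvd Nat.prime_two).2 h2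
      have c3 := (Nat.Prime.coprime_iff_not_dvd Nat.prime_three).2 h.1
      exact Nat.Coprime.mul_left c2 c3
    exact (indepNum_torus_square_add_one_le h2).antisymm (sub_one_le_indepNum_square h.1 h2 h.2)
  · have h34 : 3 ∣ n ∨ 4 ∣ n := by tauto
    exact (indepNum_torus_square_add_two_le hn h34).antisymm (sub_two_le_indepNum_square hn h34)

theorem gonality_torus {m n : ℕ} [NeZero m] [NeZero n] (hm : 2 ≤ m) (hn : 2 ≤ n) :
    gonality (toroidalQueenGraph m n) = m * n - (toroidalQueenGraph m n).indepNum := by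
  obtain ⟨s, h⟩ := firingDichotomy_torus hm hn
  rw [h.gonality_eq, Fintype.card_prod, ZMod.card, ZMod.card]

end SquareBoards

end ChipFiring

theorem theorem2 (m n : ℕ) [NeZero m] [NeZero n] (hm : 2 ≤ m) (hn : 2 ≤ n) :
    -- the gonality, in terms of the independence number
    ChipFiring.gonality (toroidalQueenGraph m n) = m * n - (toroidalQueenGraph m n).indepNum ∧
    -- square boards
    (m = n → ChipFiring.gonality (toroidalQueenGraph m n) =
      if Nat.gcd 6 n = 1 then n * (n - 1)
      else if ¬ 3 ∣ n ∧ ¬ 4 ∣ n then n * (n - 1) + 1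
      else n * (n - 1) + 2) ∧
    -- non-square boards, other than the boards with side lengths 3 and 6
    (m ≠ n → ¬ (m = 3 ∧ n = 6) → ¬ (m = 6 ∧ n = 3) →
      ChipFiring.gonality (toroidalQueenGraph m n) = m * n - Nat.gcd m n) ∧
    -- the boards with side lengths 3 and 6
    ((m = 3 ∧ n = 6) ∨ (m = 6 ∧ n = 3) → ChipFiring.gonality (toroidalQueenGraph m n) = 16) ∧
    -- maximum independent sets correspond to classes of rank one and degree the gonality
    Set.BijOn
      (fun S : Finset (ZMod m × ZMod n) =>
        ChipFiring.divisorClass (toroidalQueenGraph m n) (ChipFiring.complDivisor S))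
      {S | (toroidalQueenGraph m n).IsMaximumIndepSet S}
      {c | ∃ D : ChipFiring.Divisor (ZMod m × ZMod n),
        ChipFiring.divisorClass (toroidalQueenGraph m n) D = c ∧
        ChipFiring.degree D = (ChipFiring.gonality (toroidalQueenGraph m n) : ℤ) ∧
        ChipFiring.rank (toroidalQueenGraph m n) D = 1} := by
  have hg := ChipFiring.gonality_torus hm hn
  refine ⟨hg, ?_, fun hmn h36 h63 => ?_, ?_, ?_⟩
  · rintro rfl
    rw [hg, ChipFiring.indepNum_torus_square hm]
    obtain ⟨k, rfl⟩ := Nat.exists_eq_add_of_le hm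
    have h1 : 2 + k - 1 = k + 1 := by omega
    have h2 : 2 + k - 2 = k := by omega
    rw [h1, h2]
    split_ifs
    · exact Nat.sub_eq_of_eq_add (by ring)
    · exact Nat.sub_eq_of_eq_add (by ring)
    · exact Nat.sub_eq_of_eq_add (by ring)
  · rw [hg, ChipFiring.indepNum_torus_of_ne hmn h36 h63]
  · rintro (⟨rfl, rfl⟩ | ⟨rfl, rfl⟩)
    · have := ChipFiring.indepNum_torus_three_six
      rw [hg]
      convert congrArg (fun k => 3 * 6 - k) this
    · have := ChipFiring.indepNum_torus_six_three
      rw [hg]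
      convert congrArg (fun k => 6 * 3 - k) this
  · obtain ⟨s, h⟩ := ChipFiring.firingDichotomy_torus hm hn
    exact h.bijOn_divisorClass
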